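/- Consider $K\ge 5$ nodes and $M\ge 1$ files, and let $r\in\{1,\dots,K\}$. Each file $p$ is stored exactly at the nodes of some $r$-element set $\mathcal T_p\subseteq\{1,\dots,K\}$ (combinatorial file assignment, computation load $r$). For each node $q$ and file $p$ there is an intermediate value (IVA) $a_{q,p}$ of $A$ i.i.d. uniform bits, known to all nodes of $\mathcal T_p$; all IVAs are independent. Node $q$ must recover $a_{q,p}$ for every $p$ with $q\notin\mathcal T_p$. The nodes use a full-duplex wireless channel $n$ times: $$Y_k(t)=\sum_{k'\ne k}H_{k,k'}(t)X_{k'}(t)+Z_k(t),\qquad t=1,\dots,n,$$ where the coefficients $H_{k,k'}(t)$ are i.i.d. over time and over ordered pairs of distinct nodes, with i.i.d. real and imaginary parts of an atomless distribution on a bounded interval $[-H_{\max},H_{\max}]$, the noises $Z_k(t)$ are i.i.d. circularly-symmetric complex Gaussian of variance $1$, and IVAs, coefficients and noises are independent. All nodes know all coefficients, and $\frac1n\sum_t\mathbb E|X_k(t)|^2\le P$ for every node $k$. Transmission is non-cooperative: each $a_{q,p}$ is split into $r$ sub-messages of equal length $A/r$ ($A$ a multiple of $r$), one for each node of $\mathcal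 T_p$, and the input of node $k$ is a function of the coefficients and of the sub-messages assigned to node $k$ only. For decoding, node $k$ uses $(Y_k(t))_t$, the coefficients and all IVAs $a_{q,p}$ with $k\in\mathcal T_p$. Let $\Delta(r)$ be the infimum of $$\varliminf_{P\to\infty}\ \varliminf_{A\to\infty}\frac{n}{A\,K\,M}\log_2 P$$ over all such file assignments and all families of such non-cooperative schemes (one for each $P>0$ and each $A$) whose probability that some node fails to recover some required IVA tends to $0$ as $A\to\infty$, for every $P>0$. Then $$\Delta(r)\ \ge\ \frac1K\Bigl(1-\frac rK\Bigr)\cdot\frac{(K-2)r+K-1}{r(K-1)} .$$ Correspondingly, consider the same channel with one message of rate $R_{k,\mathcal T}\ge0$ for each $r$-element set $\mathcal T$ of nodes and each node $k\notin\mathcal T$, held by the nodes of $\mathcal T$ and intended for node $k$, all messages being independent and uniform, and each being split into $r$ sub-messages of equal rate $R_{k,\mathcal T}/r$ that are transmitted without cooperation in the above sense. With $\mathcal C(P)$ the set of rate tuples for which the error probability can be made to vanish as $n\to\infty$ under the power constraint $P$, $$\mathrm{SDoF}(r):=\varlimsup_{P\to\infty}\ \sup_{R\in\mathcal C(P)}\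 \sum_{\mathcal T}\sum_{k\notin\mathcal T}\frac{R_{k,\mathcal T}}{\log_2 P}\ \le\ \frac{K(K-1)r}{(K-2)r+K-1}.$$ -/

import Mathlib

open MeasureTheory ProbabilityTheory Filter Topology
open scoped ENNReal

noncomputable section

namespace WirelessMapReduce

/-- Ordered pairs (receiver, transmitter) of distinct nodes. -/
abbrev Link (K : ℕ) : Type := {x : Fin K × Fin K // x.1 ≠ x.2}

/-- A realization of all channel coefficients over `n` channel uses:
`H t ⟨(k, k'), _⟩` is the coefficient from node `k'` to node `k` at time `t`. -/
abbrev ChannelState (K n : ℕ) : Type := Fin n → Link K → ℂ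

/-- A realization of the receiver noises over `n` channel uses. -/
abbrev Noise (K n : ℕ) : Type := Fin n → Fin K → ℂ

/-- The law of a complex random variable whose real and imaginary parts are
i.i.d. with law `ν`. -/
def complexLaw (ν : Measure ℝ) : Measure ℂ :=
  (ν.prod ν).map Complex.measurableEquivRealProd.symm

/-- Channel coefficients: i.i.d. over time and over ordered pairs of nodes, each with
i.i.d. real and imaginary parts of law `ν`. -/
def channelLaw (K n : ℕ) (ν : Measure ℝ) : Measure (ChannelState K n) :=
  Measure.pi fun _ => Measure.pi fun _ => complexLaw ν

/-- Noise: i.i.d. over time and nodes, circularly-symmetric complex Gaussian of variance one. -/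
def noiseLaw (K n : ℕ) : Measure (Noise K n) :=
  Measure.pi fun _ => Measure.pi fun _ => complexLaw (gaussianReal 0 (1 / 2))

/-- The signal received at node `k` (full duplex, own signal removed):
`Y_k(t) = ∑_{k' ≠ k} H_{k,k'}(t) X_{k'}(t) + Z_k(t)`. -/
def received {K n : ℕ} (X : Fin K → Fin n → ℂ) (H : ChannelState K n) (Z : Noise K n)
    (k : Fin K) : Fin n → ℂ :=
  fun t => (∑ k' : {k' : Fin K // k' ≠ k}, H t ⟨(k, k'.1), k'.2.symm⟩ * X k'.1 t) + Z t k

section Messages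

variable {K : ℕ} {ι : Type} (store : ι → Finset (Fin K)) (L : ι → ℕ)

/-- All messages. Message `i` is held by the nodes in `store i` and is split into one
sub-message for each of these nodes; each sub-message takes `L i` values. -/
abbrev Messages : Type := (i : ι) → store i → Fin (L i)

/-- What node `k` may transmit: of each message that it holds, only its own sub-message. -/
abbrev Transmittable (k : Fin K) : Type := (i : {i : ι // k ∈ store i}) → Fin (L i.1)

/-- What node `k` may use for decoding: all sub-messages of all messages that it holds. -/
abbrev Known (k : Fin K) : Type := (i : {i : ι // k ∈ store i}) → store i.1 → Fin (L i.1)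

variable {store L}

/-- The sub-messages which node `k` may transmit. -/
def transmittable (w : Messages store L) (k : Fin K) : Transmittable store L k :=
  fun i => w i.1 ⟨k, i.2⟩

/-- The sub-messages known at node `k`. -/
def known (w : Messages store L) (k : Fin K) : Known store L k :=
  fun i => w i.1

end Messages

/-- A non-cooperative code of blocklength `n` over the `K`-node wireless network. Message `i` is
held by the nodes in `store i` and intended for node `dest i`. The signal of node `k` is a
function of the sub-messages assigned to `k` only; decoding uses the received signal and
everything known at the receiver. All nodes have perfect channel state information. -/
structure NonCoopCode {K : ℕ} {ι : Type} (store : ι → Finset (Fin K)) (dest : ι → Fin K)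
    (L : ι → ℕ) (n : ℕ) where
  /-- encoders -/
  enc : (k : Fin K) → Transmittable store L k → ChannelState K n → Fin n → ℂ
  enc_measurable : ∀ k m, Measurable (enc k m)
  /-- decoders: `dec i` is run at node `dest i` -/
  dec : (i : ι) → Known store L (dest i) → ChannelState K n → (Fin n → ℂ) →
    (store i → Fin (L i))
  dec_measurable : ∀ i m,
    Measurable (fun x : ChannelState K n × (Fin n → ℂ) => dec i m x.1 x.2)

namespace NonCoopCode

variable {K : ℕ} {ι : Type} [Fintype ι] {store : ι → Finset (Fin K)} {dest : ι → Fin K}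
  {L : ι → ℕ} {n : ℕ}

/-- The channel inputs for the messages `w` and the channel coefficients `H`. -/
def input (c : NonCoopCode store dest L n) (w : Messages store L) (H : ChannelState K n) :
    Fin K → Fin n → ℂ :=
  fun k => c.enc k (transmittable w k) H

/-- Joint law of messages, channel coefficients and noise: the three are independent, and all
sub-messages are independent and uniformly distributed. -/
def jointLaw (_c : NonCoopCode store dest L n) (ν : Measure ℝ) :
    Measure (Messages store L × ChannelState K n × Noise K n) :=
  (uniformOn (Set.univ : Set (Messages store L))).prod
    ((channelLaw K n ν).prod (noiseLaw K n))

/-- Average power constraint `(1/n) ∑_t E[|X_k(t)|²] ≤ P` for every node `k`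
(multiplied by `n`). -/
def PowerConstraint (c : NonCoopCode store dest L n) (ν : Measure ℝ) (P : ℝ) : Prop :=
  ∀ k, ∑ t, ∫⁻ ω, ‖c.input ω.1 ω.2.1 k t‖ₑ ^ 2 ∂(c.jointLaw ν) ≤ n * ENNReal.ofReal P

/-- The error event: some message is not recovered by its destination (messages already held
by their destination need no decoding). -/
def errorEvent (c : NonCoopCode store dest L n) :
    Set (Messages store L × ChannelState K n × Noise K n) :=
  {ω | ∃ i, dest i ∉ store i ∧
    c.dec i (known ω.1 (dest i)) ω.2.1
      (received (c.input ω.1 ω.2.1) ω.2.1 ω.2.2 (dest i)) ≠ ω.1 i}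

/-- The error probability. -/
def errorProb (c : NonCoopCode store dest L n) (ν : Measure ℝ) : ℝ≥0∞ :=
  c.jointLaw ν c.errorEvent

end NonCoopCode

/-! ### MapReduce: the normalized delivery time -/

/-- Combinatorial file assignment of load `r`: file `p` lies in the bundle of the `r`-subset
`S p` of nodes, and is stored exactly at the nodes in `S p`. -/
def IsCombinatorialAssignment {K M : ℕ} (r : ℕ) (S : Fin M → Finset (Fin K)) : Prop :=
  ∀ p, (S p).card = r

/-- A non-cooperative code for the shuffle phase. The messages are the IVAs `a_{q,p}` (function
`q`, file `p`), of `A = r * B` bits each, so that each of the `r` sub-IVAs of an IVA has `B` bits.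
The IVA `a_{q,p}` is held by the nodes storing file `p` and is needed at node `q`. -/
abbrev ShuffleCode {K M : ℕ} (S : Fin M → Finset (Fin K)) (B n : ℕ) : Type :=
  NonCoopCode (ι := Fin K × Fin M) (fun i => S i.2) (fun i => i.1) (fun _ => 2 ^ B) n

/-- The normalized delivery time `liminf_{P → ∞} liminf_{A → ∞} n / (A K M) * log P` of
blocklengths `n P B`, where the IVA length `A = r * B` runs through the multiples of `r`. -/
def ndt (K r M : ℕ) (n : ℝ → ℕ → ℕ) : EReal :=
  liminf (fun P : ℝ =>
    liminf (fun B : ℕ =>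
      (((n P B : ℝ) / (((r * B : ℕ) : ℝ) * K * M) * Real.logb 2 P : ℝ) : EReal)) atTop) atTop

/-- The NDTs that are achievable with a combinatorial file assignment of load `r` of `M` files and
non-cooperative transmission: for every power `P`, the error probability tends to zero as the
IVA length tends to infinity. -/
def achievableNDT (K r M : ℕ) (ν : Measure ℝ) : Set EReal :=
  {Δ | ∃ (S : Fin M → Finset (Fin K)) (n : ℝ → ℕ → ℕ)
      (c : (P : ℝ) → (B : ℕ) → ShuffleCode S B (n P B)),
    IsCombinatorialAssignment r S ∧
    (∀ P : ℝ, 0 < P →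
      (∀ B, (c P B).PowerConstraint ν P) ∧
      Tendsto (fun B => (c P B).errorProb ν) atTop (𝓝 0)) ∧
    Δ = ndt K r M n}

/-- The optimal NDT at computation load `r` under combinatorial file assignment and
non-cooperative transmission. -/
def optimalNDT (K r M : ℕ) (ν : Measure ℝ) : EReal :=
  sInf (achievableNDT K r M ν)

/-! ### The channel with `r`-fold shared messages: sum degrees of freedom -/

/-- Message indices `(k, T)`: a message for node `k` held by the `r`-subset `T` of the other
nodes. -/
abbrev CoopIndex (K r : ℕ) : Type :=
  {x : Fin K × Finset (Fin K) // x.2.card = r ∧ x.1 ∉ x.2}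

/-- A rate tuple is achievable at power `P` with non-cooperative transmission if there are
non-cooperative codes of all blocklengths `n` with vanishing error probability. The message of
rate `R_{k,T}` consists of `r` sub-messages of rate `R_{k,T} / r`, hence with `2^{n R_{k,T} / r}`
(rounded up) values each. -/
def IsAchievableRate {K r : ℕ} (ν : Measure ℝ) (P : ℝ) (R : CoopIndex K r → ℝ) : Prop :=
  (∀ i, 0 ≤ R i) ∧
  ∃ c : (n : ℕ) → NonCoopCode (ι := CoopIndex K r) (fun i => i.1.2) (fun i => i.1.1)
      (fun i => ⌈(2 : ℝ) ^ ((n : ℝ) * R i / r)⌉₊) n,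
    (∀ n, (c n).PowerConstraint ν P) ∧
    Tendsto (fun n => (c n).errorProb ν) atTop (𝓝 0)

/-- The sum degrees of freedom under non-cooperative transmission:
`limsup_{P → ∞} sup_R (∑ R_{k,T}) / log P` over all achievable rate tuples. -/
def sumDoF (K r : ℕ) (ν : Measure ℝ) : EReal :=
  limsup (fun P : ℝ =>
    ⨆ (R : CoopIndex K r → ℝ) (_ : IsAchievableRate ν P R),
      (((∑ i, R i) / Real.logb 2 P : ℝ) : EReal)) atTop

end WirelessMapReduce

end

noncomputable section

namespace WirelessMapReduce

/-! Fix an order `σ` of the nodes with first node `k` and last node `j`. Give a receiver at `k`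
every sub-message that is not in `IsDecodable`. It first decodes the messages for `k`, and then
knows the inputs of all nodes except `j`. Removing these from its own signal leaves the signal of
`j` in noise, and rescaling together with a correction from the genie gives all the received
signals. The receiver can then decode, in the order of `σ`, the messages whose destination precedes
all their holders; sub-messages of `j` are the only unknown part of these
(`NonCoopCode.eq_of_genieOutput_eq`).

When the coefficient from `j` to `k` is not small, the corrections are pure noise, so the output has
only one coordinate of power `P` per channel use. The decodable sub-messages therefore carry at most
about `n log P` bits. This is proved by packing instead of entropy: the noise has density at most
one, it is carried to the genie output by a volume-preserving map, and different messages occupy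
disjoint parts of one ellipsoid (`NonCoopCode.sum_noiseLaw_le`). Uses with a weak coefficient may
cost `P ^ K`, but they are rare because the law has no atom at zero.

For a uniformly random `σ`, a sub-message of an `r`-fold stored message is decodable with
probability `1/K + 1/(rK) - 1/(K(K-1))` (`countWhere_isDecodable`). Averaging gives a bound, uniform
in the code, on the total message length (`exists_sum_logb_mul_le`); both claims are limits of it.
-/

/-! ### Noise and channel laws, and volumes. -/

/-- A product measure comes from the largest outer measure that is bounded on boxes by the product,
so comparing on boxes suffices. -/
theorem measure_pi_mono {ι : Type*} [Fintype ι] {α : ι → Type*} [∀ i, MeasurableSpace (α i)]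
    {μ ν : (i : ι) → Measure (α i)} [∀ i, SigmaFinite (μ i)] [∀ i, SigmaFinite (ν i)]
    (h : ∀ i, μ i ≤ ν i) : Measure.pi μ ≤ Measure.pi ν := by
  have key : (Measure.pi μ).toOuterMeasure ≤ OuterMeasure.pi fun i => (ν i).toOuterMeasure := by
    rw [OuterMeasure.le_pi]
    intro s _
    change Measure.pi μ (Set.univ.pi s) ≤ ∏ i, ν i (s i)
    rw [Measure.pi_pi]
    exact Finset.prod_le_prod' fun i _ => h i (s i)
  refine Measure.le_iff.2 fun s hs => ?_
  calc Measure.pi μ s ≤ OuterMeasure.pi (fun i => (ν i).toOuterMeasure) s := key s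
    _ = Measure.pi ν s := by rw [Measure.pi, toMeasure_apply _ _ hs]

/-- At variance `1/2` the peak of the density is `1/√π`, which is below one. This is what lets noise
probabilities be bounded by volumes. -/
theorem gaussianReal_le_volume : gaussianReal 0 (1 / 2) ≤ volume := by
  rw [gaussianReal_of_var_ne_zero _ (by norm_num)]
  conv_rhs => rw [← withDensity_one (μ := (volume : Measure ℝ))]
  refine withDensity_mono (ae_of_all _ fun x => ?_)
  rw [gaussianPDF, Pi.one_apply, ENNReal.ofReal_le_one, gaussianPDFReal]
  have h1 : (1 : ℝ) ≤ √(2 * Real.pi * ((1 / 2 : NNReal) : ℝ)) := by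
    rw [Real.one_le_sqrt]
    push_cast
    nlinarith [Real.pi_gt_three]
  have h2 : Real.exp (-(x - 0) ^ 2 / (2 * ((1 / 2 : NNReal) : ℝ))) ≤ 1 := by
    rw [Real.exp_le_one_iff]
    exact div_nonpos_of_nonpos_of_nonneg (neg_nonpos.2 (sq_nonneg _)) (by positivity)
  exact mul_le_one₀ (inv_le_one_of_one_le₀ h1) (Real.exp_pos _).le h2

instance isProbabilityMeasure_complexLaw (ν : Measure ℝ) [IsProbabilityMeasure ν] :
    IsProbabilityMeasure (complexLaw ν) :=
  Measure.isProbabilityMeasure_map Complex.measurableEquivRealProd.symm.measurable.aemeasurable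

instance isProbabilityMeasure_channelLaw (K n : ℕ) (ν : Measure ℝ) [IsProbabilityMeasure ν] :
    IsProbabilityMeasure (channelLaw K n ν) := by
  unfold channelLaw; infer_instance

instance isProbabilityMeasure_noiseLaw (K n : ℕ) : IsProbabilityMeasure (noiseLaw K n) := by
  unfold noiseLaw; infer_instance

theorem complexLaw_gaussianReal_le_volume : complexLaw (gaussianReal 0 (1 / 2)) ≤ volume := by
  rw [complexLaw, ← (Complex.volume_preserving_equiv_real_prod.symm).map_eq]
  exact Measure.map_mono (Measure.prod_mono gaussianReal_le_volume gaussianReal_le_volume)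
    Complex.measurableEquivRealProd.symm.measurable

theorem noiseLaw_le_volume (K n : ℕ) : noiseLaw K n ≤ volume :=
  measure_pi_mono fun _ => measure_pi_mono fun _ => complexLaw_gaussianReal_le_volume

theorem lintegral_sq_gaussianReal :
    ∫⁻ x, ENNReal.ofReal (x ^ 2) ∂(gaussianReal 0 (1 / 2)) = ENNReal.ofReal (1 / 2) := by
  have h := variance_id_gaussianReal (μ := 0) (v := 1 / 2)
  rw [variance_eq_integral aemeasurable_id] at h
  simp only [id, integral_id_gaussianReal, sub_zero] at h
  have hi : Integrable (fun x : ℝ => x ^ 2) (gaussianReal 0 (1 / 2)) :=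
    (memLp_id_gaussianReal 2).integrable_sq
  rw [← ofReal_integral_eq_lintegral_ofReal hi (ae_of_all _ fun x => sq_nonneg x)]
  rw [h]; norm_num

theorem lintegral_complexLaw_gaussianReal :
    ∫⁻ z, ‖z‖ₑ ^ 2 ∂(complexLaw (gaussianReal 0 (1 / 2))) = 1 := by
  rw [complexLaw, lintegral_map_equiv]
  have h : ∀ x : ℝ × ℝ, ‖Complex.measurableEquivRealProd.symm x‖ₑ ^ 2
      = ENNReal.ofReal (x.1 ^ 2) + ENNReal.ofReal (x.2 ^ 2) := by
    intro x
    rw [← ofReal_norm, ← ENNReal.ofReal_pow (norm_nonneg _), ← Complex.normSq_eq_norm_sq,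
      ← ENNReal.ofReal_add (sq_nonneg _) (sq_nonneg _), Complex.normSq_apply]
    congr 1
    change x.1 * x.1 + x.2 * x.2 = _
    ring
  simp_rw [h]
  rw [lintegral_add_left (by fun_prop)]
  have e1 := (measurePreserving_fst (μ := gaussianReal 0 (1 / 2))
    (ν := gaussianReal 0 (1 / 2))).lintegral_comp (f := fun x => ENNReal.ofReal (x ^ 2))
    (by fun_prop)
  have e2 := (measurePreserving_snd (μ := gaussianReal 0 (1 / 2))
    (ν := gaussianReal 0 (1 / 2))).lintegral_comp (f := fun x => ENNReal.ofReal (x ^ 2))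
    (by fun_prop)
  rw [e1, e2, lintegral_sq_gaussianReal, ← ENNReal.ofReal_add (by norm_num) (by norm_num)]
  norm_num

theorem measurePreserving_channel_eval (K n : ℕ) (ν : Measure ℝ) [IsProbabilityMeasure ν]
    (t : Fin n) (l : Link K) :
    MeasurePreserving (fun H : ChannelState K n => H t l) (channelLaw K n ν) (complexLaw ν) :=
  (measurePreserving_eval (fun _ : Link K => complexLaw ν) l).comp
    (measurePreserving_eval (fun _ : Fin n => Measure.pi fun _ : Link K => complexLaw ν) t)

theorem measurePreserving_noise_eval (K n : ℕ) (t : Fin n) (k : Fin K) :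
    MeasurePreserving (fun Z : Noise K n => Z t k) (noiseLaw K n)
      (complexLaw (gaussianReal 0 (1 / 2))) :=
  (measurePreserving_eval (fun _ : Fin K => complexLaw (gaussianReal 0 (1 / 2))) k).comp
    (measurePreserving_eval
      (fun _ : Fin n => Measure.pi fun _ : Fin K => complexLaw (gaussianReal 0 (1 / 2))) t)

theorem ae_norm_complexLaw_le {ν : Measure ℝ} [IsProbabilityMeasure ν] {Hmax : ℝ}
    (hν : ∀ᵐ x ∂ν, x ∈ Set.Icc (-Hmax) Hmax) :
    ∀ᵐ z ∂(complexLaw ν), ‖z‖ ≤ 2 * |Hmax| := by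
  rw [complexLaw, ae_map_iff Complex.measurableEquivRealProd.symm.measurable.aemeasurable
    (measurableSet_le measurable_norm measurable_const)]
  have h1 : ∀ᵐ x ∂(ν.prod ν), x.1 ∈ Set.Icc (-Hmax) Hmax :=
    Measure.quasiMeasurePreserving_fst.ae hν
  have h2 : ∀ᵐ x ∂(ν.prod ν), x.2 ∈ Set.Icc (-Hmax) Hmax :=
    Measure.quasiMeasurePreserving_snd.ae hν
  filter_upwards [h1, h2] with x hx1 hx2
  have a1 : |x.1| ≤ |Hmax| := abs_le_abs hx1.2 (by linarith [hx1.1])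
  have a2 : |x.2| ≤ |Hmax| := abs_le_abs hx2.2 (by linarith [hx2.1])
  calc ‖Complex.measurableEquivRealProd.symm x‖ ≤ |x.1| + |x.2| :=
        Complex.norm_le_abs_re_add_abs_im _
    _ ≤ _ := by linarith

/-- The law of a coefficient does not charge zero, and measures are continuous along decreasing
sets. Atomlessness enters the argument only here. -/
theorem exists_complexLaw_norm_lt_le {ν : Measure ℝ} [IsProbabilityMeasure ν]
    [NullSingletonClass ν] {p : ℝ} (hp : 0 < p) :
    ∃ ε : ℝ, 0 < ε ∧ complexLaw ν {z | ‖z‖ < ε} ≤ ENNReal.ofReal p := by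
  have h0 : complexLaw ν {z | ‖z‖ ≤ 0} = 0 := by
    rw [complexLaw, MeasurableEquiv.map_apply]
    have hs : (Complex.measurableEquivRealProd.symm ⁻¹' {z | ‖z‖ ≤ 0}) ⊆ ({0} : Set ℝ) ×ˢ {0} := by
      intro x hx
      have hx' : Complex.measurableEquivRealProd.symm x = 0 := norm_le_zero_iff.1 hx
      exact ⟨congrArg Complex.re hx', congrArg Complex.im hx'⟩
    refine measure_mono_null hs ?_
    rw [Measure.prod_prod]
    simp
  have ht := tendsto_measure_biInter_gt (μ := complexLaw ν) (s := fun ε : ℝ => {z : ℂ | ‖z‖ ≤ ε})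
    (a := 0) (fun r _ => (measurableSet_le measurable_norm measurable_const).nullMeasurableSet)
    (fun i j _ hij z hz => le_trans hz hij) ⟨1, one_pos, measure_ne_top _ _⟩
  have he : (⋂ r > (0 : ℝ), {z : ℂ | ‖z‖ ≤ r}) = {z | ‖z‖ ≤ 0} := by
    ext z
    simp only [Set.mem_iInter, Set.mem_ofPred_eq]
    exact ⟨fun h => le_of_forall_gt_imp_ge_of_dense h, fun h r hr => h.trans hr.le⟩
  rw [he, h0] at ht
  have hev := (ht.eventually (gt_mem_nhds (ENNReal.ofReal_pos.2 hp))).and self_mem_nhdsWithin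
  obtain ⟨ε, h1, h2⟩ := hev.exists
  have hsub : {z : ℂ | ‖z‖ < ε} ⊆ {z | ‖z‖ ≤ ε} := fun z (hz : ‖z‖ < ε) => (hz.le : ‖z‖ ≤ ε)
  exact ⟨ε, h2, (measure_mono hsub).trans h1.le⟩

/-- The map is a transvection along `b`; as `b k = 0`, its determinant is one. -/
theorem measurePreserving_shear {κ : Type*} [Fintype κ] (k : κ) (b : κ → ℂ) (hb : b k = 0) :
    MeasurePreserving (fun z : κ → ℂ => fun q => z q + z k * b q) volume volume := by
  classical
  let f : (κ → ℂ) →ₗ[ℂ] (κ → ℂ) := LinearMap.transvection (LinearMap.proj k) b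
  have hdet : LinearMap.det (f.restrictScalars ℝ) = 1 := by
    rw [LinearMap.det_restrictScalars, LinearMap.transvection.det]
    simp [hb]
  have h := Measure.map_linearMap_addHaar_eq_smul_addHaar (μ := (volume : Measure (κ → ℂ)))
    (f := f.restrictScalars ℝ) (by rw [hdet]; exact one_ne_zero)
  rw [hdet] at h
  refine ⟨by fun_prop, ?_⟩
  rw [inv_one, abs_one, ENNReal.ofReal_one, one_smul] at h
  exact h

theorem integral_exp_neg_norm_sq_div {τ : ℝ} (hτ : 0 < τ) :
    ∫ z : ℂ, Real.exp (-(‖z‖ ^ 2 / τ)) = Real.pi * τ := by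
  have h := GaussianFourier.integral_rexp_neg_mul_sq_norm (V := ℂ) (inv_pos.2 hτ)
  rw [Complex.finrank_real_complex] at h
  have e : ∀ z : ℂ, -(‖z‖ ^ 2 / τ) = -τ⁻¹ * ‖z‖ ^ 2 := fun z => by ring
  simp_rw [e, h]
  norm_num

/-- The volume of a complex ellipsoid with squared semi-axes proportional to `τ`. -/
theorem volume_ellipsoid_le {ι κ : Type*} [Fintype ι] [Fintype κ] (τ : ι → κ → ℝ)
    (hτ : ∀ t q, 0 < τ t q) (c : ℝ) :
    volume {y : ι → κ → ℂ | ∑ t, ∑ q, ‖y t q‖ ^ 2 / τ t q ≤ c}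
      ≤ ENNReal.ofReal (Real.exp c * ∏ t, ∏ q, (Real.pi * τ t q)) := by
  have hint : ∀ t q, Integrable (fun z : ℂ => Real.exp (-(‖z‖ ^ 2 / τ t q))) := fun t q =>
    Integrable.of_integral_ne_zero (by
      rw [integral_exp_neg_norm_sq_div (hτ t q)]
      exact (mul_pos Real.pi_pos (hτ t q)).ne')
  have hint2 : Integrable (fun y : ι → κ → ℂ => ∏ t, ∏ q, Real.exp (-(‖y t q‖ ^ 2 / τ t q))) :=
    Integrable.fintype_prod (f := fun t (x : κ → ℂ) => ∏ q, Real.exp (-(‖x q‖ ^ 2 / τ t q)))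
      fun t => Integrable.fintype_prod (f := fun q (z : ℂ) => Real.exp (-(‖z‖ ^ 2 / τ t q)))
        fun q => hint t q
  have hval : ∫ y : ι → κ → ℂ, ∏ t, ∏ q, Real.exp (-(‖y t q‖ ^ 2 / τ t q))
      = ∏ t, ∏ q, (Real.pi * τ t q) := by
    rw [integral_fintype_prod_volume_eq_prod (𝕜 := ℝ)
      (fun t (x : κ → ℂ) => ∏ q, Real.exp (-(‖x q‖ ^ 2 / τ t q)))]
    refine Finset.prod_congr rfl fun t _ => ?_
    rw [integral_fintype_prod_volume_eq_prod (𝕜 := ℝ)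
      (fun q (z : ℂ) => Real.exp (-(‖z‖ ^ 2 / τ t q)))]
    exact Finset.prod_congr rfl fun q _ => integral_exp_neg_norm_sq_div (hτ t q)
  have hmeas : MeasurableSet {y : ι → κ → ℂ | ∑ t, ∑ q, ‖y t q‖ ^ 2 / τ t q ≤ c} :=
    measurableSet_le (by fun_prop) measurable_const
  -- Chernoff bound: the indicator of the ellipsoid is at most `exp (c - ∑ ‖y‖² / τ)`, whose
  -- integral factors into Gaussian integrals.
  rw [← hval, ← integral_const_mul, ofReal_integral_eq_lintegral_ofReal (hint2.const_mul _)
    (ae_of_all _ fun y => by positivity), ← lintegral_indicator_one hmeas]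
  refine lintegral_mono fun y => ?_
  by_cases hy : ∑ t, ∑ q, ‖y t q‖ ^ 2 / τ t q ≤ c
  · rw [Set.indicator_of_mem (by exact hy), Pi.one_apply, ENNReal.one_le_ofReal]
    simp_rw [← Real.exp_sum]
    rw [← Real.exp_add, Real.one_le_exp_iff]
    simp only [Finset.sum_neg_distrib]
    linarith
  · rw [Set.indicator_of_notMem (by exact hy)]
    exact zero_le

/-! ### The genie-aided receiver: reconstruction of signals and size of its output. -/

section GenieOutput

variable {K n : ℕ}

/-- The coefficient from node `j` to node `q`, with zero self-coefficient. -/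
def crossCoeff (H : ChannelState K n) (j q : Fin K) (t : Fin n) : ℂ :=
  if h : q ≠ j then H t ⟨(q, j), h⟩ else 0

/-- The part of the signal at node `q` which is not sent by node `j`. -/
def signalExcept (j : Fin K) (X : Fin K → Fin n → ℂ) (H : ChannelState K n) (q : Fin K)
    (t : Fin n) : ℂ :=
  ∑ k' : {k' : Fin K // k' ≠ q}, if k'.1 = j then 0 else H t ⟨(q, k'.1), k'.2.symm⟩ * X k'.1 t

/-- The factor with which the noise of node `k` is mixed into the genie output of node `q`:
it is nonzero only when the coefficient from `j` to `k` is at least `ε`. -/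
def mixFactor (ε : ℝ) (k j : Fin K) (H : ChannelState K n) (t : Fin n) (q : Fin K) : ℂ :=
  if q = k then 0
  else if ε ≤ ‖crossCoeff H j k t‖ then -(crossCoeff H j q t / crossCoeff H j k t) else 0

/-- The signal part of the genie output. -/
def genieSignal (ε : ℝ) (k j : Fin K) (X : Fin K → Fin n → ℂ) (H : ChannelState K n)
    (t : Fin n) (q : Fin K) : ℂ :=
  if q = k then signalExcept j X H k t + crossCoeff H j k t * X j t
  else if ε ≤ ‖crossCoeff H j k t‖ then 0 else crossCoeff H j q t * X j t

/-- The output of a genie-aided receiver at node `k`: it sees its own received signal and, for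
every other node, a noisy correction from which the signal of node `j` at that node can be
computed. -/
def genieOutput (ε : ℝ) (k j : Fin K) (X : Fin K → Fin n → ℂ) (H : ChannelState K n)
    (Z : Noise K n) (t : Fin n) (q : Fin K) : ℂ :=
  Z t q + Z t k * mixFactor ε k j H t q + genieSignal ε k j X H t q

theorem received_eq (X : Fin K → Fin n → ℂ) (H : ChannelState K n) (Z : Noise K n) (j q : Fin K)
    (t : Fin n) :
    received X H Z q t = signalExcept j X H q t + (crossCoeff H j q t * X j t + Z t q) := by
  rw [received, signalExcept, ← add_assoc]
  congr 1
  by_cases hq : q ≠ j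
  · rw [crossCoeff, dif_pos hq,
      ← Finset.add_sum_erase _ _ (Finset.mem_univ (⟨j, hq.symm⟩ : {k' : Fin K // k' ≠ q})),
      ← Finset.add_sum_erase _ (fun k' : {k' : Fin K // k' ≠ q} =>
        if k'.1 = j then 0 else H t ⟨(q, k'.1), k'.2.symm⟩ * X k'.1 t)
        (Finset.mem_univ (⟨j, hq.symm⟩ : {k' : Fin K // k' ≠ q})), if_pos rfl, zero_add, add_comm]
    congr 1
    refine Finset.sum_congr rfl fun x hx => ?_
    rw [if_neg fun h => Finset.ne_of_mem_erase hx (Subtype.ext h)]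
  · rw [crossCoeff, dif_neg hq, zero_mul, add_zero]
    refine Finset.sum_congr rfl fun x _ => ?_
    rw [if_neg fun h => hq fun h' => x.2 (h.trans h'.symm)]

theorem genieOutput_self (ε : ℝ) (k j : Fin K) (X : Fin K → Fin n → ℂ) (H : ChannelState K n)
    (Z : Noise K n) (t : Fin n) : genieOutput ε k j X H Z t k = received X H Z k t := by
  rw [received_eq X H Z j, genieOutput, mixFactor, genieSignal, if_pos rfl, if_pos rfl]
  ring

/-- For a strong coefficient, the signal of `j` seen at `k` is rescaled by the ratio of the
coefficients, and the genie output at `q` replaces the rescaled noise of `k` by that of `q`. For a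
weak one the mixing factor is zero and the genie output is already the left side. -/
theorem crossSignal_eq {ε : ℝ} (hε : 0 < ε) {k q : Fin K} (hq : q ≠ k) (j : Fin K)
    (X : Fin K → Fin n → ℂ) (H : ChannelState K n) (Z : Noise K n) (t : Fin n) :
    crossCoeff H j q t * X j t + Z t q = genieOutput ε k j X H Z t q -
      mixFactor ε k j H t q * (genieOutput ε k j X H Z t k - signalExcept j X H k t) := by
  rw [genieOutput_self, received_eq X H Z j, genieOutput, mixFactor, genieSignal, if_neg hq,
    if_neg hq]
  by_cases h : ε ≤ ‖crossCoeff H j k t‖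
  · have h0 : crossCoeff H j k t ≠ 0 := norm_pos_iff.1 (hε.trans_le h)
    rw [if_pos h, if_pos h]
    field_simp
    ring
  · rw [if_neg h, if_neg h]
    ring

theorem signalExcept_congr {j : Fin K} {X X' : Fin K → Fin n → ℂ} (h : ∀ q, q ≠ j → X q = X' q)
    (H : ChannelState K n) (q : Fin K) (t : Fin n) :
    signalExcept j X H q t = signalExcept j X' H q t := by
  refine Finset.sum_congr rfl fun x _ => ?_
  by_cases hx : x.1 = j
  · rw [if_pos hx, if_pos hx]
  · rw [if_neg hx, if_neg hx, h _ hx]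

/-- The genie output and the signals of the nodes other than `j` determine all received
signals except that of `j`. -/
theorem received_congr {ε : ℝ} (hε : 0 < ε) {k j : Fin K} {X X' : Fin K → Fin n → ℂ}
    (hX : ∀ q, q ≠ j → X q = X' q) {H : ChannelState K n} {Z Z' : Noise K n}
    (hG : genieOutput ε k j X H Z = genieOutput ε k j X' H Z') (q : Fin K) :
    received X H Z q = received X' H Z' q := by
  funext t
  by_cases hq : q = k
  · subst hq
    rw [← genieOutput_self ε q j X H Z t, ← genieOutput_self ε q j X' H Z' t, hG]
  · rw [received_eq X H Z j, received_eq X' H Z' j, crossSignal_eq hε hq, crossSignal_eq hε hq, hG,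
      signalExcept_congr hX H q t, signalExcept_congr hX H k t]

theorem norm_crossCoeff_le {H : ChannelState K n} {h : ℝ} (h0 : 0 ≤ h) (hH : ∀ t l, ‖H t l‖ ≤ h)
    (j q : Fin K) (t : Fin n) : ‖crossCoeff H j q t‖ ≤ h := by
  rw [crossCoeff]
  split_ifs
  · exact hH _ _
  · simpa using h0

theorem sq_norm_add_le (a b : ℂ) : ‖a + b‖ ^ 2 ≤ 2 * (‖a‖ ^ 2 + ‖b‖ ^ 2) := by
  have := norm_add_le a b
  nlinarith [norm_nonneg (a + b), norm_nonneg a, norm_nonneg b, sq_nonneg (‖a‖ - ‖b‖)]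

theorem sq_norm_received_le {X : Fin K → Fin n → ℂ} {H : ChannelState K n} {h : ℝ}
    (hH : ∀ t l, ‖H t l‖ ≤ h) (Z : Noise K n) (k : Fin K) (t : Fin n) :
    ‖received X H Z k t‖ ^ 2 ≤ 2 * (K * h ^ 2 * ∑ q, ‖X q t‖ ^ 2 + ‖Z t k‖ ^ 2) := by
  refine (sq_norm_add_le _ _).trans ?_
  gcongr
  have hcard : (Fintype.card {k' : Fin K // k' ≠ k} : ℝ) ≤ K := by
    exact_mod_cast (Fintype.card_subtype_le _).trans (Fintype.card_fin K).le
  calc ‖∑ k' : {k' : Fin K // k' ≠ k}, H t ⟨(k, k'.1), k'.2.symm⟩ * X k'.1 t‖ ^ 2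
      ≤ (∑ k' : {k' : Fin K // k' ≠ k}, h * ‖X k'.1 t‖) ^ 2 := by
        gcongr
        refine (norm_sum_le _ _).trans (Finset.sum_le_sum fun x _ => ?_)
        rw [norm_mul]
        gcongr
        exact hH _ _
    _ ≤ Fintype.card {k' : Fin K // k' ≠ k} *
        ∑ k' : {k' : Fin K // k' ≠ k}, (h * ‖X k'.1 t‖) ^ 2 := sq_sum_le_card_mul_sum_sq
    _ ≤ K * ∑ k' : {k' : Fin K // k' ≠ k}, (h * ‖X k'.1 t‖) ^ 2 := by gcongr
    _ = K * h ^ 2 * ∑ k' : {k' : Fin K // k' ≠ k}, ‖X k'.1 t‖ ^ 2 := by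
        simp_rw [mul_pow, ← Finset.mul_sum, mul_assoc]
    _ ≤ K * h ^ 2 * ∑ q, ‖X q t‖ ^ 2 := by
        gcongr
        rw [← Finset.sum_subtype (Finset.univ.filter (· ≠ k)) (by simp) fun q => ‖X q t‖ ^ 2]
        exact Finset.sum_le_sum_of_subset_of_nonneg (Finset.filter_subset _ _)
          fun _ _ _ => sq_nonneg _

/-- The order of magnitude of the genie output: `P` for node `k`, and for all nodes when the
coefficient from `j` to `k` is small, and `1` otherwise. -/
def genieScale (ε P : ℝ) (k j : Fin K) (H : ChannelState K n) (t : Fin n) (q : Fin K) : ℝ :=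
  if q = k ∨ ‖crossCoeff H j k t‖ < ε then P else 1

/-- The energy of signals (in units of `P`) and noises. -/
def energy (P : ℝ) (X : Fin K → Fin n → ℂ) (Z : Noise K n) : ℝ :=
  ∑ t, ∑ q, (‖X q t‖ ^ 2 / P + ‖Z t q‖ ^ 2)

/-- The constant in the comparison of the genie output with the energy. -/
def energyFactor (K : ℕ) (ε h : ℝ) : ℝ := K * (2 * (K + 1) * (h ^ 2 + (h / ε) ^ 2 + 1))

/-- With a strong coefficient, the coordinates `q ≠ k` contain two noises and no signal, and the
mixing factor is at most `h / ε`; hence the scale `1`. All other coordinates contain signals, which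
the energy measures in units of `P`, and `1 ≤ P` absorbs their noise. -/
theorem sum_genieOutput_le {ε P h : ℝ} (hε : 0 < ε) (hP : 1 ≤ P) (h0 : 0 ≤ h) {k j : Fin K}
    {X : Fin K → Fin n → ℂ} {H : ChannelState K n} (hH : ∀ t l, ‖H t l‖ ≤ h) (Z : Noise K n) :
    ∑ t, ∑ q, ‖genieOutput ε k j X H Z t q‖ ^ 2 / genieScale ε P k j H t q
      ≤ energyFactor K ε h * energy P X Z := by
  rw [energy, Finset.mul_sum]
  refine Finset.sum_le_sum fun t _ => ?_
  set x := ∑ q, ‖X q t‖ ^ 2 with hx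
  set z := ∑ q, ‖Z t q‖ ^ 2 with hz
  have hE : ∑ q, (‖X q t‖ ^ 2 / P + ‖Z t q‖ ^ 2) = x / P + z := by
    rw [Finset.sum_add_distrib, Finset.sum_div]
  have hP0 : 0 < P := by linarith
  have hXq : ∀ q, ‖X q t‖ ^ 2 ≤ x := fun q =>
    Finset.single_le_sum (f := fun q => ‖X q t‖ ^ 2) (fun _ _ => sq_nonneg _) (Finset.mem_univ q)
  have hZq : ∀ q, ‖Z t q‖ ^ 2 ≤ z := fun q =>
    Finset.single_le_sum (f := fun q => ‖Z t q‖ ^ 2) (fun _ _ => sq_nonneg _) (Finset.mem_univ q)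
  have hx0 : 0 ≤ x := Finset.sum_nonneg fun _ _ => sq_nonneg _
  have hz0 : 0 ≤ z := Finset.sum_nonneg fun _ _ => sq_nonneg _
  have hK : (0 : ℝ) ≤ K := Nat.cast_nonneg K
  have hzP : z ≤ P * z := le_mul_of_one_le_left hz0 hP
  rw [hE]
  have key : ∀ q, ‖genieOutput ε k j X H Z t q‖ ^ 2 / genieScale ε P k j H t q
      ≤ 2 * (K + 1) * (h ^ 2 + (h / ε) ^ 2 + 1) * (x / P + z) := by
    intro q
    have hxP : x / P + z = (x + P * z) / P := by field_simp
    have hu : 0 ≤ (h / ε) ^ 2 := sq_nonneg _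
    have hh : 0 ≤ h ^ 2 := sq_nonneg _
    by_cases hq : q = k
    · subst hq
      rw [genieOutput_self, genieScale, if_pos (Or.inl rfl), hxP, ← mul_div_assoc]
      gcongr
      refine (sq_norm_received_le hH Z q t).trans ?_
      have := hZq q
      calc 2 * (K * h ^ 2 * x + ‖Z t q‖ ^ 2) ≤ 2 * (K * h ^ 2 * x + P * z) := by linarith
        _ ≤ 2 * ((K + 1) * (h ^ 2 + (h / ε) ^ 2 + 1) * x +
              (K + 1) * (h ^ 2 + (h / ε) ^ 2 + 1) * (P * z)) := by
            have a1 : (K : ℝ) * h ^ 2 ≤ (K + 1) * (h ^ 2 + (h / ε) ^ 2 + 1) := by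
              nlinarith
            have a2 : (1 : ℝ) ≤ (K + 1) * (h ^ 2 + (h / ε) ^ 2 + 1) := by nlinarith
            have a3 := mul_le_mul_of_nonneg_right a1 hx0
            have a4 := mul_le_mul_of_nonneg_right a2 (hz0.trans hzP)
            linarith
        _ = _ := by ring
    · by_cases hb : ‖crossCoeff H j k t‖ < ε
      · rw [genieScale, if_pos (Or.inr hb), genieOutput, mixFactor, genieSignal, if_neg hq,
          if_neg hq, if_neg hb.not_ge, if_neg hb.not_ge, mul_zero, add_zero, hxP, ← mul_div_assoc]
        gcongr
        refine (sq_norm_add_le _ _).trans ?_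
        rw [norm_mul, mul_pow]
        have b1 : ‖crossCoeff H j q t‖ ^ 2 ≤ h ^ 2 := by
          gcongr
          exact norm_crossCoeff_le h0 hH j q t
        have b2 := mul_le_mul b1 (hXq j) (sq_nonneg _) hh
        have b3 := hZq q
        have a1 : h ^ 2 ≤ (K + 1) * (h ^ 2 + (h / ε) ^ 2 + 1) := by nlinarith
        have a2 : (1 : ℝ) ≤ (K + 1) * (h ^ 2 + (h / ε) ^ 2 + 1) := by nlinarith
        have a3 := mul_le_mul_of_nonneg_right a1 hx0
        have a4 := mul_le_mul_of_nonneg_right a2 (hz0.trans hzP)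
        linarith
      · rw [genieScale, if_neg (not_or.2 ⟨hq, hb⟩), genieOutput, mixFactor, genieSignal, if_neg hq,
          if_neg hq, if_pos (not_lt.1 hb), if_pos (not_lt.1 hb), add_zero, div_one]
        refine (sq_norm_add_le _ _).trans ?_
        rw [norm_mul, mul_pow, norm_neg, norm_div]
        have b1 : (‖crossCoeff H j q t‖ / ‖crossCoeff H j k t‖) ^ 2 ≤ (h / ε) ^ 2 := by
          gcongr
          · exact norm_crossCoeff_le h0 hH j q t
          · exact not_lt.1 hb
        have b2 := mul_le_mul (hZq k) b1 (sq_nonneg _) hz0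
        have b3 := hZq q
        have a2 : (h / ε) ^ 2 + 1 ≤ (K + 1) * (h ^ 2 + (h / ε) ^ 2 + 1) := by nlinarith
        have a4 := mul_le_mul_of_nonneg_right a2 hz0
        have a5 : 0 ≤ 2 * (K + 1) * (h ^ 2 + (h / ε) ^ 2 + 1) * (x / P) := by positivity
        linarith
  refine (Finset.sum_le_sum fun q _ => key q).trans ?_
  rw [Finset.sum_const, Finset.card_univ, Fintype.card_fin, nsmul_eq_mul, energyFactor]
  exact le_of_eq (by ring)

/-- Each use contributes one factor `P` from coordinate `k`. A weak use contributes `P ^ K` in truth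
and is charged `P * P ^ K`, which is harmless and keeps the product uniform. -/
theorem prod_genieScale_le {ε P : ℝ} (hP : 1 ≤ P) (k j : Fin K) (H : ChannelState K n) :
    ∏ t, ∏ q, (Real.pi * genieScale ε P k j H t q)
      ≤ (Real.pi ^ K * P) ^ n *
        P ^ (K * (Finset.univ.filter fun t => ‖crossCoeff H j k t‖ < ε).card) := by
  have hP0 : 0 < P := by linarith
  have key : ∀ t, ∏ q, (Real.pi * genieScale ε P k j H t q)
      ≤ (Real.pi ^ K * P) * if ‖crossCoeff H j k t‖ < ε then P ^ K else 1 := by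
    intro t
    rw [Finset.prod_mul_distrib, Finset.prod_const, Finset.card_univ, Fintype.card_fin, mul_assoc]
    refine mul_le_mul_of_nonneg_left ?_ (by positivity)
    by_cases hb : ‖crossCoeff H j k t‖ < ε
    · simp only [genieScale, hb, or_true, if_true, Finset.prod_const, Finset.card_univ,
        Fintype.card_fin]
      exact le_mul_of_one_le_left (by positivity) hP
    · simp only [genieScale, hb, or_false, if_false, mul_one]
      rw [Finset.prod_ite_eq' Finset.univ k fun _ => P]
      simp
  refine (Finset.prod_le_prod (fun t _ => Finset.prod_nonneg fun q _ => ?_)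
    fun t _ => key t).trans ?_
  · rw [genieScale]; split_ifs <;> positivity
  · rw [Finset.prod_mul_distrib, Finset.prod_const, Finset.card_univ, Fintype.card_fin,
      Finset.prod_ite, Finset.prod_const, Finset.prod_const_one, mul_one, pow_mul]

end GenieOutput

/-! ### Successive decoding and sphere packing. -/

section

variable {K : ℕ} {ι : Type} {store : ι → Finset (Fin K)} {dest : ι → Fin K}
  {L : ι → ℕ} {n : ℕ}

/-- The sub-messages that a receiver at node `k` can decode when it is helped by a genie: those
intended for `k`, and of those sent by `j` an acyclic set with respect to the order `σ`. -/
def IsDecodable (store : ι → Finset (Fin K)) (dest : ι → Fin K) (σ : Equiv.Perm (Fin K))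
    (k j : Fin K) (x : (i : ι) × store i) : Prop :=
  (dest x.1 = k ∧ k ∉ store x.1) ∨ (x.2.1 = j ∧ ∀ m ∈ store x.1, σ (dest x.1) < σ m)

/-- Successive decoding, stated as injectivity: correct decoding makes each message a function of
what its destination knows and receives. No message held by the first node `k` is decodable, so
decoding at `k` can start at once. -/
theorem NonCoopCode.eq_of_genieOutput_eq (c : NonCoopCode store dest L n) {ε : ℝ} (hε : 0 < ε)
    {σ : Equiv.Perm (Fin K)} {k j : Fin K} (hk : ∀ q, σ k ≤ σ q) {w w' : Messages store L}
    {H : ChannelState K n} {Z Z' : Noise K n}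
    (hagree : ∀ x : (i : ι) × store i, ¬ IsDecodable store dest σ k j x → w x.1 x.2 = w' x.1 x.2)
    (hw : (w, H, Z) ∉ c.errorEvent) (hw' : (w', H, Z') ∉ c.errorEvent)
    (hG : genieOutput ε k j (c.input w H) H Z = genieOutput ε k j (c.input w' H) H Z') :
    w = w' := by
  have hdec : ∀ i, dest i ∉ store i → known w (dest i) = known w' (dest i) →
      received (c.input w H) H Z (dest i) = received (c.input w' H) H Z' (dest i) → w i = w' i := by
    intro i hi h1 h2
    simp only [NonCoopCode.errorEvent, Set.mem_ofPred_eq, not_exists, not_and, not_not] at hw hw'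
    rw [← hw i hi, ← hw' i hi, h1, h2]
  have hfirst : ∀ i, dest i = k → k ∉ store i → w i = w' i := by
    intro i hi hki
    refine hdec i (hi ▸ hki) ?_ ?_
    · funext ⟨i', hi'⟩
      funext m
      refine hagree ⟨i', m⟩ ?_
      rintro (⟨_, h⟩ | ⟨_, h⟩)
      · exact h (hi ▸ hi')
      · exact absurd (h k (hi ▸ hi')) (hk _).not_gt
    · funext t
      rw [hi, ← genieOutput_self ε k j _ H Z t, ← genieOutput_self ε k j _ H Z' t, hG]
  -- Non-cooperation is used here: the input of `q` depends only on sub-messages assigned to `q`,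
  -- and for `q ≠ j` these are given or were decoded at `k`.
  have hinput : ∀ q, q ≠ j → c.input w H q = c.input w' H q := by
    intro q hq
    have : transmittable w q = transmittable w' q := by
      funext ⟨i, hi⟩
      by_cases hx : IsDecodable store dest σ k j ⟨i, q, hi⟩
      · rcases hx with ⟨h1, h2⟩ | ⟨h1, _⟩
        · exact congrFun (hfirst i h1 h2) _
        · exact absurd h1 hq
      · exact hagree _ hx
    simp only [NonCoopCode.input, this]
  have hrec := received_congr hε hinput hG
  -- Strong induction on the position of the destination: a message of this kind that is held at
  -- `dest i` has its own destination strictly earlier.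
  have hsucc : ∀ (a : ℕ) (i : ι), (σ (dest i) : ℕ) = a → (∀ m ∈ store i, σ (dest i) < σ m) →
      w i = w' i := by
    intro a
    induction a using Nat.strong_induction_on with
    | _ a ih =>
      intro i hia hi
      refine hdec i (fun h => (hi _ h).false) ?_ (hrec _)
      funext ⟨i', hi'⟩
      funext m
      by_cases hx : IsDecodable store dest σ k j ⟨i', m⟩
      · rcases hx with ⟨h1, h2⟩ | ⟨_, h2⟩
        · exact congrFun (hfirst i' h1 h2) _
        · exact congrFun (ih _ (hia ▸ h2 _ hi') i' rfl h2) _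
      · exact hagree _ hx
  funext i m
  by_cases hx : IsDecodable store dest σ k j ⟨i, m⟩
  · rcases hx with ⟨h1, h2⟩ | ⟨_, h2⟩
    · exact congrFun (hfirst i h1 h2) _
    · exact congrFun (hsucc _ i rfl h2) _
  · exact hagree _ hx

theorem NonCoopCode.measurable_input (c : NonCoopCode store dest L n) (w : Messages store L) :
    Measurable (c.input w) :=
  measurable_pi_lambda _ fun k => c.enc_measurable k _

theorem measurable_received (k : Fin K) :
    Measurable fun x : (Fin K → Fin n → ℂ) × ChannelState K n × Noise K n =>
      received x.1 x.2.1 x.2.2 k := by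
  unfold received
  fun_prop

variable [Fintype ι]

theorem measurable_messages_prod {α β : Type*} [MeasurableSpace α] [MeasurableSpace β]
    {f : Messages store L × α → β} (hf : ∀ w, Measurable fun a => f (w, a)) : Measurable f :=
  measurable_from_prod_countable_right hf

theorem NonCoopCode.measurableSet_errorEvent (c : NonCoopCode store dest L n) :
    MeasurableSet c.errorEvent := by
  have : c.errorEvent = ⋃ i, {ω | dest i ∉ store i ∧ c.dec i (known ω.1 (dest i)) ω.2.1
      (received (c.input ω.1 ω.2.1) ω.2.1 ω.2.2 (dest i)) ≠ ω.1 i} := by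
    ext ω
    simp [NonCoopCode.errorEvent]
  rw [this]
  refine MeasurableSet.iUnion fun i => ?_
  by_cases hi : dest i ∈ store i
  · simp [hi]
  simp only [hi, not_false_eq_true, true_and]
  refine (measurableSet_eq_fun ?_ (by fun_prop)).compl
  have h (w : Messages store L) : Measurable fun a : ChannelState K n × Noise K n =>
      c.dec i (known w (dest i)) a.1 (received (c.input w a.1) a.1 a.2 (dest i)) := by
    have h1 : Measurable fun a : ChannelState K n × Noise K n => (c.input w a.1, a.1, a.2) :=
      ((c.measurable_input w).comp measurable_fst).prodMk measurable_id
    have h2 := (measurable_received (dest i)).comp h1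
    have h3 : Measurable fun a : ChannelState K n × Noise K n =>
        (a.1, received (c.input w a.1) a.1 a.2 (dest i)) := measurable_fst.prodMk h2
    have h4 := (c.dec_measurable i (known w (dest i))).comp h3
    exact h4
  have h' := measurable_messages_prod (f := fun ω : Messages store L × ChannelState K n × Noise K n =>
    c.dec i (known ω.1 (dest i)) ω.2.1
      (received (c.input ω.1 ω.2.1) ω.2.1 ω.2.2 (dest i))) h
  exact h'

theorem measurable_energy (P : ℝ) :
    Measurable fun x : (Fin K → Fin n → ℂ) × Noise K n => energy P x.1 x.2 := by
  unfold energy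
  fun_prop

theorem NonCoopCode.measurable_energy_input (c : NonCoopCode store dest L n) (P : ℝ) :
    Measurable fun ω : Messages store L × ChannelState K n × Noise K n =>
      energy P (c.input ω.1 ω.2.1) ω.2.2 := by
  have h (w : Messages store L) : Measurable fun a : ChannelState K n × Noise K n =>
      energy P (c.input w a.1) a.2 := by
    have h1 : Measurable fun a : ChannelState K n × Noise K n => (c.input w a.1, a.2) :=
      ((c.measurable_input w).comp measurable_fst).prodMk measurable_snd
    have h2 := (measurable_energy P).comp h1
    exact h2
  exact measurable_messages_prod h

/-- The noise that leads to the genie output `y`. -/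
def noiseOfGenieOutput (ε : ℝ) (k j : Fin K) (X : Fin K → Fin n → ℂ) (H : ChannelState K n)
    (y : Fin n → Fin K → ℂ) : Noise K n :=
  fun t q => (y t q + -genieSignal ε k j X H t q) +
    (y t k + -genieSignal ε k j X H t k) * -mixFactor ε k j H t q

theorem mixFactor_self (ε : ℝ) (k j : Fin K) (H : ChannelState K n) (t : Fin n) :
    mixFactor ε k j H t k = 0 := if_pos rfl

theorem genieOutput_noiseOfGenieOutput (ε : ℝ) (k j : Fin K) (X : Fin K → Fin n → ℂ)
    (H : ChannelState K n) (y : Fin n → Fin K → ℂ) :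
    genieOutput ε k j X H (noiseOfGenieOutput ε k j X H y) = y := by
  funext t q
  simp only [genieOutput, noiseOfGenieOutput, mixFactor_self]
  ring

/-- A translation by the signal part, followed by a shear at each time. -/
theorem measurePreserving_noiseOfGenieOutput (ε : ℝ) (k j : Fin K) (X : Fin K → Fin n → ℂ)
    (H : ChannelState K n) :
    MeasurePreserving (noiseOfGenieOutput ε k j X H) volume volume := by
  have h1 : MeasurePreserving (fun y : Fin n → Fin K → ℂ => y + fun t q => -genieSignal ε k j X H t q)
      volume volume := measurePreserving_add_right _ _
  have h2 : MeasurePreserving (fun (y : Fin n → Fin K → ℂ) t q =>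
      y t q + y t k * -mixFactor ε k j H t q) volume volume :=
    volume_preserving_pi fun t => measurePreserving_shear k (fun q => -mixFactor ε k j H t q)
      (by rw [mixFactor_self, neg_zero])
  exact h2.comp h1

/-- Sphere packing: for a fixed channel state, messages which differ only in decodable
sub-messages and are received without error lead to disjoint sets of genie outputs. -/
theorem NonCoopCode.sum_noiseLaw_le (c : NonCoopCode store dest L n) {ε P h e : ℝ} (hε : 0 < ε)
    (hP : 1 ≤ P) (h0 : 0 ≤ h) {σ : Equiv.Perm (Fin K)} {k j : Fin K} (hk : ∀ q, σ k ≤ σ q)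
    {H : ChannelState K n} (hH : ∀ t l, ‖H t l‖ ≤ h) (F : Finset (Messages store L))
    (hF : ∀ w ∈ F, ∀ w' ∈ F, ∀ x : (i : ι) × store i, ¬ IsDecodable store dest σ k j x →
      w x.1 x.2 = w' x.1 x.2) :
    ∑ w ∈ F, noiseLaw K n {Z | (w, H, Z) ∉ c.errorEvent ∧ energy P (c.input w H) Z ≤ e}
      ≤ ENNReal.ofReal (Real.exp (energyFactor K ε h * e) * ((Real.pi ^ K * P) ^ n *
        P ^ (K * (Finset.univ.filter fun t => ‖crossCoeff H j k t‖ < ε).card))) := by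
  set A : Messages store L → Set (Noise K n) :=
    fun w => {Z | (w, H, Z) ∉ c.errorEvent ∧ energy P (c.input w H) Z ≤ e} with hA
  have hAm : ∀ w, MeasurableSet (A w) := fun w => by
    refine MeasurableSet.inter ?_ ?_
    · exact (c.measurableSet_errorEvent.compl).preimage
        (measurable_prodMk_left.comp measurable_prodMk_left)
    · exact measurableSet_le ((measurable_energy P).comp measurable_prodMk_left) measurable_const
  set B : Messages store L → Set (Fin n → Fin K → ℂ) :=
    fun w => noiseOfGenieOutput ε k j (c.input w H) H ⁻¹' A w with hB
  have hmp := fun w => measurePreserving_noiseOfGenieOutput ε k j (c.input w H) H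
  -- A common genie output of two correctly decoded messages would force them to be equal.
  have hdisj : (F : Set (Messages store L)).PairwiseDisjoint B := by
    intro w hw w' hw' hne
    refine Set.disjoint_left.2 fun y hy hy' => hne ?_
    exact c.eq_of_genieOutput_eq hε hk (hF w hw w' hw') hy.1 hy'.1
      (by rw [genieOutput_noiseOfGenieOutput, genieOutput_noiseOfGenieOutput])
  have hP0 : 0 < P := by linarith
  have hτ : ∀ t q, 0 < genieScale ε P k j H t q := fun t q => by
    rw [genieScale]; split_ifs <;> positivity
  calc ∑ w ∈ F, noiseLaw K n (A w) ≤ ∑ w ∈ F, volume (B w) := by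
        refine Finset.sum_le_sum fun w _ => ?_
        rw [hB, (hmp w).measure_preimage (hAm w).nullMeasurableSet]
        exact noiseLaw_le_volume K n _
    _ = volume (⋃ w ∈ F, B w) :=
        (measure_biUnion_finset hdisj fun w _ => (hmp w).measurable (hAm w)).symm
    _ ≤ volume {y : Fin n → Fin K → ℂ | ∑ t, ∑ q, ‖y t q‖ ^ 2 / genieScale ε P k j H t q
          ≤ energyFactor K ε h * e} := by
        refine measure_mono (Set.iUnion₂_subset fun w _ y hy => ?_)
        have h1 := sum_genieOutput_le (k := k) (j := j) (X := c.input w H) hε hP h0 hH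
          (noiseOfGenieOutput ε k j (c.input w H) H y)
        rw [genieOutput_noiseOfGenieOutput] at h1
        refine h1.trans (mul_le_mul_of_nonneg_left hy.2 ?_)
        unfold energyFactor
        positivity
    _ ≤ _ := by
        refine (volume_ellipsoid_le _ hτ _).trans (ENNReal.ofReal_le_ofReal ?_)
        exact mul_le_mul_of_nonneg_left (prod_genieScale_le hP k j H) (Real.exp_pos _).le

end

/-! ### From packing to a bound on the decodable bits of a code. -/

section

theorem measure_gt_four_mul_le {Ω : Type*} [MeasurableSpace Ω] {μ : Measure Ω} {f : Ω → ℝ}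
    (hf : Measurable f) {a : ℝ} (ha : 0 ≤ a) (h : ∫⁻ ω, ENNReal.ofReal (f ω) ∂μ ≤ ENNReal.ofReal a) :
    μ {ω | 4 * a < f ω} ≤ ENNReal.ofReal (1 / 4) := by
  -- Markov's inequality divides by `a`, so `a = 0` is separate; it occurs at blocklength zero.
  rcases ha.eq_or_lt with rfl | ha
  · rw [ENNReal.ofReal_zero, nonpos_iff_eq_zero, lintegral_eq_zero_iff (by fun_prop)] at h
    have h0 : μ {ω | 4 * 0 < f ω} = 0 := by
      refine measure_mono_null ?_ (ae_iff.1 h)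
      intro ω hω
      have hω' : 0 < f ω := by simpa using hω
      simpa using hω'
    rw [h0]
    exact zero_le
  · have h1 : μ {ω | 4 * a < f ω} ≤ μ {ω | ENNReal.ofReal (4 * a) ≤ ENNReal.ofReal (f ω)} :=
      measure_mono fun ω (hω : 4 * a < f ω) => ENNReal.ofReal_le_ofReal hω.le
    refine h1.trans ((meas_ge_le_lintegral_div (by fun_prop) (by simpa using ha)
      ENNReal.ofReal_ne_top).trans ?_)
    refine (ENNReal.div_le_div_right h _).trans ?_
    rw [← ENNReal.ofReal_div_of_pos (by linarith)]
    refine ENNReal.ofReal_le_ofReal (le_of_eq ?_)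
    field_simp

variable {K : ℕ} {ι : Type} [Fintype ι] {store : ι → Finset (Fin K)} {dest : ι → Fin K}
  {L : ι → ℕ} {n : ℕ}

/-- Fixing the sub-messages outside `D` splits the messages into `∏ x ∈ Dᶜ, L x.1` classes, each
contributing at most `Λ`. -/
theorem sum_messages_le [DecidableEq ι] (D : Finset ((i : ι) × store i)) (f : Messages store L → ℝ≥0∞) (Λ : ℝ≥0∞)
    (hf : ∀ F : Finset (Messages store L), (∀ w ∈ F, ∀ w' ∈ F, ∀ x : (i : ι) × store i, x ∉ D →
      w x.1 x.2 = w' x.1 x.2) → ∑ w ∈ F, f w ≤ Λ) :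
    (∏ x ∈ D, (L x.1 : ℝ≥0∞)) * ∑ w, f w ≤ Fintype.card (Messages store L) * Λ := by
  classical
  let ρ : Messages store L → ((x : {x : (i : ι) × store i // x ∉ D}) → Fin (L x.1.1)) :=
    fun w x => w x.1.1 x.1.2
  have h1 : ∑ w, f w ≤ (∏ x ∈ Dᶜ, (L x.1 : ℝ≥0∞)) * Λ := by
    rw [← Finset.sum_fiberwise Finset.univ ρ f]
    refine (Finset.sum_le_sum fun g _ => hf _ ?_).trans (le_of_eq ?_)
    · intro w hw w' hw' x hx
      have h2 := ((Finset.mem_filter.1 hw).2).trans ((Finset.mem_filter.1 hw').2).symm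
      exact congrFun h2 ⟨x, hx⟩
    · rw [Finset.sum_const, Finset.card_univ, Fintype.card_pi, nsmul_eq_mul]
      congr 1
      simp_rw [Fintype.card_fin]
      push_cast
      rw [← Finset.prod_subtype (p := fun x => x ∉ D) Dᶜ (by simp) fun x => (L x.1 : ℝ≥0∞)]
  have h2 : (Fintype.card (Messages store L) : ℝ≥0∞) =
      (∏ x ∈ D, (L x.1 : ℝ≥0∞)) * ∏ x ∈ Dᶜ, (L x.1 : ℝ≥0∞) := by
    rw [Finset.prod_mul_prod_compl, Fintype.prod_sigma, Fintype.card_pi]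
    push_cast
    refine Finset.prod_congr rfl fun i _ => ?_
    simp
  rw [h2, mul_assoc]
  gcongr

/-- The constant in the bound on the logarithm of the volume of the genie outputs. -/
def packingConstant (K : ℕ) (ε h : ℝ) : ℝ :=
  energyFactor K ε h * (8 * K) / Real.log 2 + K * Real.logb 2 Real.pi

namespace NonCoopCode

/-- The event of correct decoding under typical energy, number of weak coefficients from `j` to
`k`, and bounded coefficients. -/
def typicalEvent (c : NonCoopCode store dest L n) (ε P h e b : ℝ) (k j : Fin K) :
    Set (Messages store L × ChannelState K n × Noise K n) :=
  {ω | ω ∉ c.errorEvent ∧ energy P (c.input ω.1 ω.2.1) ω.2.2 ≤ e ∧ (∀ t l, ‖ω.2.1 t l‖ ≤ h) ∧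
    ((Finset.univ.filter fun t => ‖crossCoeff ω.2.1 j k t‖ < ε).card : ℝ) ≤ b}

theorem measurable_crossCoeff (j k : Fin K) (t : Fin n) :
    Measurable fun H : ChannelState K n => crossCoeff H j k t := by
  unfold crossCoeff
  split_ifs <;> fun_prop

theorem card_weak_eq (H : ChannelState K n) (j k : Fin K) (ε : ℝ) :
    ((Finset.univ.filter fun t => ‖crossCoeff H j k t‖ < ε).card : ℝ)
      = ∑ t, {H : ChannelState K n | ‖crossCoeff H j k t‖ < ε}.indicator (fun _ => (1 : ℝ)) H := by
  rw [Finset.card_filter]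
  push_cast
  refine Finset.sum_congr rfl fun t _ => ?_
  simp [Set.indicator_apply]

theorem measurableSet_weak (j k : Fin K) (ε : ℝ) (t : Fin n) :
    MeasurableSet {H : ChannelState K n | ‖crossCoeff H j k t‖ < ε} :=
  measurableSet_lt (measurable_crossCoeff j k t).norm measurable_const

theorem measurable_card_weak (j k : Fin K) (ε : ℝ) :
    Measurable fun H : ChannelState K n =>
      ((Finset.univ.filter fun t => ‖crossCoeff H j k t‖ < ε).card : ℝ) := by
  simp_rw [card_weak_eq]
  exact Finset.measurable_sum _ fun t _ =>
    measurable_const.indicator (measurableSet_weak j k ε t)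

theorem measurableSet_typicalEvent (c : NonCoopCode store dest L n) (ε P h e b : ℝ)
    (k j : Fin K) : MeasurableSet (c.typicalEvent ε P h e b k j) := by
  refine c.measurableSet_errorEvent.compl.inter
    ((measurableSet_le (c.measurable_energy_input P) measurable_const).inter
      (MeasurableSet.inter ?_ ?_))
  · have : {ω : Messages store L × ChannelState K n × Noise K n | ∀ t l, ‖ω.2.1 t l‖ ≤ h}
        = ⋂ t, ⋂ l, {ω | ‖ω.2.1 t l‖ ≤ h} := by
      ext ω; simp
    have h2 : MeasurableSet
        {ω : Messages store L × ChannelState K n × Noise K n | ∀ t l, ‖ω.2.1 t l‖ ≤ h} := by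
      rw [this]
      exact MeasurableSet.iInter fun t => MeasurableSet.iInter fun l =>
        measurableSet_le (by fun_prop) measurable_const
    exact h2
  · have h1 : Measurable fun ω : Messages store L × ChannelState K n × Noise K n => ω.2.1 :=
      measurable_fst.comp measurable_snd
    have h2 := (measurable_card_weak (n := n) j k ε).comp h1
    exact measurableSet_le h2 measurable_const

theorem card_mul_jointLaw_le [DecidableEq ι] (c : NonCoopCode store dest L n) (ν : Measure ℝ) [IsProbabilityMeasure ν]
    {G : Set (Messages store L × ChannelState K n × Noise K n)} (hG : MeasurableSet G) :
    Fintype.card (Messages store L) * c.jointLaw ν G ≤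
      ∫⁻ H, ∑ w, noiseLaw K n {Z | (w, H, Z) ∈ G} ∂(channelLaw K n ν) := by
  have hsec : ∀ w : Messages store L, MeasurableSet (Prod.mk w ⁻¹' G) := fun w =>
    hG.preimage measurable_prodMk_left
  have hm : ∀ w : Messages store L, Measurable fun H : ChannelState K n =>
      noiseLaw K n {Z | (w, H, Z) ∈ G} := fun w => measurable_measure_prodMk_left (hsec w)
  have hu : ∀ w : Messages store L,
      uniformOn (Set.univ : Set (Messages store L)) {w} =
        (Fintype.card (Messages store L) : ℝ≥0∞)⁻¹ := by
    intro w
    rw [uniformOn_univ, Measure.count_singleton, one_div]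
  rw [jointLaw, Measure.prod_apply hG, lintegral_fintype]
  simp_rw [hu]
  rw [← Finset.sum_mul, mul_comm _ (_)⁻¹, ← mul_assoc,
    lintegral_finsetSum _ fun w _ => hm w]
  refine (mul_le_of_le_one_left zero_le (ENNReal.mul_inv_le_one _)).trans ?_
  refine Finset.sum_le_sum fun w _ => ?_
  rw [Measure.prod_apply (hsec w)]
  exact le_rfl

open Classical in
/-- The sub-messages decodable with the help of a genie. -/
def decodable (store : ι → Finset (Fin K)) (dest : ι → Fin K) (σ : Equiv.Perm (Fin K))
    (k j : Fin K) : Finset ((i : ι) × store i) :=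
  Finset.univ.filter (IsDecodable store dest σ k j)

/-- Packing holds for each channel state separately and is then integrated. States with a large
coefficient or too many weak uses have an empty section of the typical event. -/
theorem prod_decodable_mul_le (c : NonCoopCode store dest L n) (ν : Measure ℝ)
    [IsProbabilityMeasure ν] {ε P h e b : ℝ} (hε : 0 < ε)
    (hP : 1 ≤ P) (h0 : 0 ≤ h) {σ : Equiv.Perm (Fin K)} {k j : Fin K} (hk : ∀ q, σ k ≤ σ q)
    (hL : ∀ i, 0 < L i) :
    (∏ x ∈ decodable store dest σ k j, (L x.1 : ℝ≥0∞)) *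
        c.jointLaw ν (c.typicalEvent ε P h e b k j)
      ≤ ENNReal.ofReal (Real.exp (energyFactor K ε h * e) * ((Real.pi ^ K * P) ^ n *
        P ^ (K * b))) := by
  classical
  set Λ := ENNReal.ofReal (Real.exp (energyFactor K ε h * e) * ((Real.pi ^ K * P) ^ n *
        P ^ (K * b))) with hΛ
  have hP0 : 0 < P := by linarith
  have hcard : (Fintype.card (Messages store L) : ℝ≥0∞) ≠ 0 := by
    have : Nonempty (Messages store L) := ⟨fun i _ => ⟨0, hL i⟩⟩
    exact_mod_cast Fintype.card_ne_zero
  have hH : ∀ H : ChannelState K n, (∏ x ∈ decodable store dest σ k j, (L x.1 : ℝ≥0∞)) *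
      ∑ w, noiseLaw K n {Z | (w, H, Z) ∈ c.typicalEvent ε P h e b k j}
        ≤ Fintype.card (Messages store L) * Λ := by
    intro H
    refine sum_messages_le _ _ _ fun F hF => ?_
    by_cases hgood : (∀ t l, ‖H t l‖ ≤ h) ∧
        ((Finset.univ.filter fun t => ‖crossCoeff H j k t‖ < ε).card : ℝ) ≤ b
    · refine (Finset.sum_le_sum fun w _ => measure_mono ?_).trans
        ((c.sum_noiseLaw_le (e := e) hε hP h0 (j := j) hk hgood.1 F ?_).trans ?_)
      · exact fun Z hZ => ⟨hZ.1, hZ.2.1⟩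
      · exact fun w hw w' hw' x hx => hF w hw w' hw' x (by simpa [decodable] using hx)
      · refine ENNReal.ofReal_le_ofReal ?_
        gcongr
        rw [← Real.rpow_natCast]
        refine Real.rpow_le_rpow_of_exponent_le hP ?_
        push_cast
        exact mul_le_mul_of_nonneg_left hgood.2 (Nat.cast_nonneg K)
    · refine (le_of_eq (Finset.sum_eq_zero fun w _ => ?_)).trans zero_le
      have : {Z | (w, H, Z) ∈ c.typicalEvent ε P h e b k j} = ∅ := by
        refine Set.eq_empty_of_forall_notMem fun Z hZ => hgood ⟨hZ.2.2.1, hZ.2.2.2⟩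
      rw [this, measure_empty]
  have h1 := c.card_mul_jointLaw_le ν (c.measurableSet_typicalEvent ε P h e b k j)
  refine (ENNReal.mul_le_mul_iff_right hcard (ENNReal.natCast_ne_top _)).1 ?_
  calc (Fintype.card (Messages store L) : ℝ≥0∞) *
        ((∏ x ∈ decodable store dest σ k j, (L x.1 : ℝ≥0∞)) *
          c.jointLaw ν (c.typicalEvent ε P h e b k j))
      = (∏ x ∈ decodable store dest σ k j, (L x.1 : ℝ≥0∞)) *
        (Fintype.card (Messages store L) * c.jointLaw ν (c.typicalEvent ε P h e b k j)) := by ring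
    _ ≤ (∏ x ∈ decodable store dest σ k j, (L x.1 : ℝ≥0∞)) *
        ∫⁻ H, ∑ w, noiseLaw K n {Z | (w, H, Z) ∈ c.typicalEvent ε P h e b k j}
          ∂(channelLaw K n ν) := by gcongr
    _ = ∫⁻ H, (∏ x ∈ decodable store dest σ k j, (L x.1 : ℝ≥0∞)) *
        ∑ w, noiseLaw K n {Z | (w, H, Z) ∈ c.typicalEvent ε P h e b k j}
          ∂(channelLaw K n ν) := by
        rw [lintegral_const_mul']
        exact ENNReal.prod_ne_top fun x _ => ENNReal.natCast_ne_top _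
    _ ≤ ∫⁻ _, Fintype.card (Messages store L) * Λ ∂(channelLaw K n ν) := lintegral_mono hH
    _ = Fintype.card (Messages store L) * Λ := by simp

theorem isProbabilityMeasure_jointLaw (c : NonCoopCode store dest L n) (ν : Measure ℝ)
    [IsProbabilityMeasure ν] (hL : ∀ i, 0 < L i) : IsProbabilityMeasure (c.jointLaw ν) := by
  have : Nonempty (Messages store L) := ⟨fun i _ => ⟨0, hL i⟩⟩
  unfold jointLaw
  infer_instance

/-- One `K * n` comes from the power constraint in units of `P`, the other from unit noise
variances. -/
theorem lintegral_energy_le (c : NonCoopCode store dest L n) (ν : Measure ℝ)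
    [IsProbabilityMeasure ν] (hL : ∀ i, 0 < L i) {P : ℝ} (hP : 0 < P)
    (hc : c.PowerConstraint ν P) :
    ∫⁻ ω, ENNReal.ofReal (energy P (c.input ω.1 ω.2.1) ω.2.2) ∂(c.jointLaw ν)
      ≤ ENNReal.ofReal (2 * K * n) := by
  have := c.isProbabilityMeasure_jointLaw ν hL
  have hPtop : ENNReal.ofReal P ≠ ∞ := ENNReal.ofReal_ne_top
  have hP0 : ENNReal.ofReal P ≠ 0 := by simpa using hP
  have he : ∀ ω : Messages store L × ChannelState K n × Noise K n,
      ENNReal.ofReal (energy P (c.input ω.1 ω.2.1) ω.2.2) =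
        ∑ q, ∑ t, ((ENNReal.ofReal P)⁻¹ * ‖c.input ω.1 ω.2.1 q t‖ₑ ^ 2 + ‖ω.2.2 t q‖ₑ ^ 2) := by
    intro ω
    rw [energy, Finset.sum_comm, ENNReal.ofReal_sum_of_nonneg fun _ _ =>
      Finset.sum_nonneg fun _ _ => by positivity]
    refine Finset.sum_congr rfl fun q _ => ?_
    rw [ENNReal.ofReal_sum_of_nonneg fun _ _ => by positivity]
    refine Finset.sum_congr rfl fun t _ => ?_
    rw [ENNReal.ofReal_add (by positivity) (by positivity), ENNReal.ofReal_div_of_pos hP,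
      ENNReal.ofReal_pow (norm_nonneg _), ENNReal.ofReal_pow (norm_nonneg _), ofReal_norm,
      ofReal_norm, div_eq_mul_inv, mul_comm]
  have hmX : ∀ q t, Measurable fun ω : Messages store L × ChannelState K n × Noise K n =>
      ‖c.input ω.1 ω.2.1 q t‖ₑ ^ 2 := by
    intro q t
    have h1 : ∀ w : Messages store L, Measurable fun a : ChannelState K n × Noise K n =>
        c.input w a.1 q t := fun w => by
      have h2 : Measurable fun a : ChannelState K n × Noise K n => c.input w a.1 :=
        (c.measurable_input w).comp measurable_fst
      fun_prop
    have h3 : Measurable fun ω : Messages store L × ChannelState K n × Noise K n =>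
      c.input ω.1 ω.2.1 q t := measurable_messages_prod h1
    exact h3.enorm.pow_const 2
  have hZ : ∀ q t, ∫⁻ ω, ‖ω.2.2 t q‖ₑ ^ 2 ∂(c.jointLaw ν) = 1 := by
    intro q t
    have : Nonempty (Messages store L) := ⟨fun i _ => ⟨0, hL i⟩⟩
    have hmp : MeasurePreserving (fun ω : Messages store L × ChannelState K n × Noise K n =>
        ω.2.2 t q) (c.jointLaw ν) (complexLaw (gaussianReal 0 (1 / 2))) :=
      (measurePreserving_noise_eval K n t q).comp (measurePreserving_snd.comp measurePreserving_snd)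
    have h1 := hmp.lintegral_comp (f := fun z => ‖z‖ₑ ^ 2) (by fun_prop)
    rw [h1, lintegral_complexLaw_gaussianReal]
  simp_rw [he]
  rw [lintegral_finsetSum _ fun q _ => by fun_prop]
  have hq : ∀ q, ∫⁻ ω, ∑ t, ((ENNReal.ofReal P)⁻¹ * ‖c.input ω.1 ω.2.1 q t‖ₑ ^ 2 +
      ‖ω.2.2 t q‖ₑ ^ 2) ∂(c.jointLaw ν) ≤ 2 * n := by
    intro q
    rw [lintegral_finsetSum _ fun t _ => by fun_prop]
    have ht : ∀ t, ∫⁻ ω, ((ENNReal.ofReal P)⁻¹ * ‖c.input ω.1 ω.2.1 q t‖ₑ ^ 2 +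
        ‖ω.2.2 t q‖ₑ ^ 2) ∂(c.jointLaw ν) =
        (ENNReal.ofReal P)⁻¹ * ∫⁻ ω, ‖c.input ω.1 ω.2.1 q t‖ₑ ^ 2 ∂(c.jointLaw ν) + 1 := by
      intro t
      rw [lintegral_add_left ((hmX q t).const_mul _), lintegral_const_mul _ (hmX q t), hZ]
    simp_rw [ht]
    rw [Finset.sum_add_distrib, ← Finset.mul_sum]
    calc _ ≤ (ENNReal.ofReal P)⁻¹ * (n * ENNReal.ofReal P) + ∑ _t : Fin n, 1 := by
          gcongr
          exact hc q
      _ = 2 * n := by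
          rw [mul_comm (n : ℝ≥0∞), ← mul_assoc, ENNReal.inv_mul_cancel hP0 hPtop]
          simp [two_mul]
  refine (Finset.sum_le_sum fun q _ => hq q).trans (le_of_eq ?_)
  rw [Finset.sum_const, Finset.card_univ, Fintype.card_fin, nsmul_eq_mul,
    ENNReal.ofReal_mul (by positivity), ENNReal.ofReal_mul (by norm_num)]
  simp only [ENNReal.ofReal_natCast, ENNReal.ofReal_ofNat]
  ring

theorem lintegral_card_weak_le (ν : Measure ℝ) [IsProbabilityMeasure ν] {ε p : ℝ}
    (hε : complexLaw ν {z | ‖z‖ < ε} ≤ ENNReal.ofReal p) {k j : Fin K} (hkj : k ≠ j) :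
    ∫⁻ H : ChannelState K n, ENNReal.ofReal
      ((Finset.univ.filter fun t => ‖crossCoeff H j k t‖ < ε).card : ℝ) ∂(channelLaw K n ν)
      ≤ ENNReal.ofReal (n * p) := by
  have h1 : ∀ H : ChannelState K n, ENNReal.ofReal
      ((Finset.univ.filter fun t => ‖crossCoeff H j k t‖ < ε).card : ℝ) =
      ∑ t, {H : ChannelState K n | ‖crossCoeff H j k t‖ < ε}.indicator (fun _ => (1 : ℝ≥0∞)) H := by
    intro H
    rw [ENNReal.ofReal_natCast, Finset.card_filter]
    push_cast
    refine Finset.sum_congr rfl fun t _ => ?_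
    simp [Set.indicator_apply]
  simp_rw [h1]
  rw [lintegral_finsetSum _ fun t _ => measurable_const.indicator (measurableSet_weak j k ε t)]
  have h2 : ∀ t : Fin n, ∫⁻ H, {H : ChannelState K n | ‖crossCoeff H j k t‖ < ε}.indicator
      (fun _ => (1 : ℝ≥0∞)) H ∂(channelLaw K n ν) ≤ ENNReal.ofReal p := by
    intro t
    rw [lintegral_indicator_const (measurableSet_weak j k ε t), one_mul]
    refine le_trans (le_of_eq ?_) hε
    rw [← (measurePreserving_channel_eval K n ν t ⟨(k, j), hkj⟩).measure_preimage
      (measurableSet_lt measurable_norm measurable_const).nullMeasurableSet]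
    congr 1
    ext H
    simp [crossCoeff, hkj]
  refine (Finset.sum_le_sum fun t _ => h2 t).trans (le_of_eq ?_)
  rw [Finset.sum_const, Finset.card_univ, Fintype.card_fin, nsmul_eq_mul,
    ENNReal.ofReal_mul (Nat.cast_nonneg n), ENNReal.ofReal_natCast]

/-- The thresholds are four times the bounds on the means, so decoding error, excess energy and
excess weak uses cost at most `1/4` each; large coefficients have probability zero. -/
theorem jointLaw_typicalEvent_ge (c : NonCoopCode store dest L n) (ν : Measure ℝ)
    [IsProbabilityMeasure ν] (hL : ∀ i, 0 < L i) {P ε p h : ℝ} (hP : 0 < P) (hp : 0 < p)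
    (hε : complexLaw ν {z | ‖z‖ < ε} ≤ ENNReal.ofReal p)
    (hh : ∀ᵐ z ∂(complexLaw ν), ‖z‖ ≤ h) {k j : Fin K} (hkj : k ≠ j)
    (hc : c.PowerConstraint ν P) (herr : c.errorProb ν ≤ ENNReal.ofReal (1 / 4)) :
    ENNReal.ofReal (1 / 4) ≤ c.jointLaw ν
      (c.typicalEvent ε P h (4 * (2 * K * n)) (4 * (n * p)) k j) := by
  have := c.isProbabilityMeasure_jointLaw ν hL
  have : Nonempty (Messages store L) := ⟨fun i _ => ⟨0, hL i⟩⟩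
  set G := c.typicalEvent ε P h (4 * (2 * K * n)) (4 * (n * p)) k j with hG
  have hmp : MeasurePreserving (fun ω : Messages store L × ChannelState K n × Noise K n =>
      ω.2.1) (c.jointLaw ν) (channelLaw K n ν) :=
    measurePreserving_fst.comp measurePreserving_snd
  have hE := measure_gt_four_mul_le (c.measurable_energy_input P) (by positivity)
    (c.lintegral_energy_le ν hL hP hc)
  have hW : c.jointLaw ν {ω | 4 * (n * p) <
      ((Finset.univ.filter fun t => ‖crossCoeff ω.2.1 j k t‖ < ε).card : ℝ)}
      ≤ ENNReal.ofReal (1 / 4) := by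
    have h1 := measure_gt_four_mul_le (measurable_card_weak (n := n) j k ε) (a := n * p)
      (by positivity) (lintegral_card_weak_le ν hε hkj)
    rw [← hmp.measure_preimage (measurableSet_lt measurable_const
      (measurable_card_weak j k ε)).nullMeasurableSet] at h1
    exact h1
  have hB : c.jointLaw ν {ω | ¬ ∀ t l, ‖ω.2.1 t l‖ ≤ h} = 0 := by
    refine ae_iff.1 (ae_all_iff.2 fun t => ae_all_iff.2 fun l => ?_)
    exact ((measurePreserving_channel_eval K n ν t l).comp hmp).quasiMeasurePreserving.ae hh
  have hcover : Set.univ ⊆ G ∪ (c.errorEvent ∪ ({ω | 4 * (2 * K * n) <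
      energy P (c.input ω.1 ω.2.1) ω.2.2} ∪ ({ω | 4 * (n * p) <
      ((Finset.univ.filter fun t => ‖crossCoeff ω.2.1 j k t‖ < ε).card : ℝ)} ∪
      {ω | ¬ ∀ t l, ‖ω.2.1 t l‖ ≤ h}))) := by
    intro ω _
    by_cases h1 : ω ∈ c.errorEvent
    · exact Or.inr (Or.inl h1)
    by_cases h2 : energy P (c.input ω.1 ω.2.1) ω.2.2 ≤ 4 * (2 * K * n)
    · by_cases h3 : ((Finset.univ.filter fun t => ‖crossCoeff ω.2.1 j k t‖ < ε).card : ℝ)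
          ≤ 4 * (n * p)
      · by_cases h4 : ∀ t l, ‖ω.2.1 t l‖ ≤ h
        · exact Or.inl ⟨h1, h2, h4, h3⟩
        · exact Or.inr (Or.inr (Or.inr (Or.inr h4)))
      · exact Or.inr (Or.inr (Or.inr (Or.inl (not_le.1 h3))))
    · exact Or.inr (Or.inr (Or.inl (not_le.1 h2)))
  have h1 : (1 : ℝ≥0∞) ≤ c.jointLaw ν G + ENNReal.ofReal (3 / 4) := by
    calc (1 : ℝ≥0∞) = c.jointLaw ν Set.univ := measure_univ.symm
      _ ≤ c.jointLaw ν G + (ENNReal.ofReal (1 / 4) + (ENNReal.ofReal (1 / 4) +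
          (ENNReal.ofReal (1 / 4) + 0))) := by
          refine (measure_mono hcover).trans ((measure_union_le _ _).trans ?_)
          gcongr
          refine (measure_union_le _ _).trans (add_le_add herr ?_)
          refine (measure_union_le _ _).trans (add_le_add hE ?_)
          exact (measure_union_le _ _).trans (add_le_add hW hB.le)
      _ = _ := by
          rw [add_zero, ← ENNReal.ofReal_add (by norm_num) (by norm_num),
            ← ENNReal.ofReal_add (by norm_num) (by norm_num)]
          norm_num
  have h2 : (1 : ℝ≥0∞) = ENNReal.ofReal (1 / 4) + ENNReal.ofReal (3 / 4) := by
    rw [← ENNReal.ofReal_add (by norm_num) (by norm_num)]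
    norm_num
  rw [h2] at h1
  exact (ENNReal.add_le_add_iff_right ENNReal.ofReal_ne_top).1 h1

/-- Logarithm of the packing bound: `2` comes from the probability `1/4`, `log P` from the strong
coordinate, `4 * K * p` from weak uses. -/
theorem sum_decodable_logb_le (c : NonCoopCode store dest L n) (ν : Measure ℝ)
    [IsProbabilityMeasure ν] (hL : ∀ i, 0 < L i) {P ε p h : ℝ} (hP : 1 ≤ P) (hp : 0 < p)
    (hε0 : 0 < ε) (h0 : 0 ≤ h) (hε : complexLaw ν {z | ‖z‖ < ε} ≤ ENNReal.ofReal p)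
    (hh : ∀ᵐ z ∂(complexLaw ν), ‖z‖ ≤ h) {σ : Equiv.Perm (Fin K)} {k j : Fin K} (hkj : k ≠ j)
    (hk : ∀ q, σ k ≤ σ q)
    (hc : c.PowerConstraint ν P) (herr : c.errorProb ν ≤ ENNReal.ofReal (1 / 4)) :
    ∑ x ∈ decodable store dest σ k j, Real.logb 2 (L x.1) ≤
      2 + n * (packingConstant K ε h + (1 + 4 * K * p) * Real.logb 2 P) := by
  have hP0 : 0 < P := by linarith
  have h1 := c.jointLaw_typicalEvent_ge ν hL hP0 hp hε hh hkj hc herr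
  have h2 := c.prod_decodable_mul_le ν (e := 4 * (2 * K * n)) (b := 4 * (n * p)) hε0 hP h0
    (j := j) hk hL
  have h3 : ENNReal.ofReal ((∏ x ∈ decodable store dest σ k j, (L x.1 : ℝ)) * (1 / 4)) ≤
      ENNReal.ofReal (Real.exp (energyFactor K ε h * (4 * (2 * K * n))) *
        ((Real.pi ^ K * P) ^ n * P ^ (K * (4 * (n * p))))) := by
    refine le_trans ?_ ((mul_le_mul_right h1 _).trans h2)
    rw [ENNReal.ofReal_mul (Finset.prod_nonneg fun _ _ => Nat.cast_nonneg _),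
      ENNReal.ofReal_prod_of_nonneg fun _ _ => Nat.cast_nonneg _]
    simp only [ENNReal.ofReal_natCast, le_refl]
  rw [ENNReal.ofReal_le_ofReal_iff (by positivity)] at h3
  have hLpos : ∀ x : (i : ι) × store i, (L x.1 : ℝ) ≠ 0 := fun x =>
    Nat.cast_ne_zero.2 (hL x.1).ne'
  have hprod : 0 < ∏ x ∈ decodable store dest σ k j, (L x.1 : ℝ) :=
    Finset.prod_pos fun x _ => Nat.cast_pos.2 (hL x.1)
  have h4 := Real.logb_le_logb_of_le one_lt_two (by positivity) h3
  rw [Real.logb_mul hprod.ne' (by norm_num), Real.logb_prod _ _ fun x _ => hLpos x,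
    Real.logb_mul (Real.exp_pos _).ne' (by positivity), Real.logb_mul (by positivity)
    (by positivity), Real.logb_pow, Real.logb_mul (by positivity) hP0.ne', Real.logb_pow,
    Real.logb_rpow_eq_mul_logb_of_pos hP0] at h4
  have e1 : Real.logb 2 (1 / 4) = -2 := by
    rw [show (1 / 4 : ℝ) = 2 ^ (-2 : ℝ) by norm_num [Real.rpow_neg]]
    exact Real.logb_rpow (by norm_num) (by norm_num)
  have e2 : Real.logb 2 (Real.exp (energyFactor K ε h * (4 * (2 * K * n)))) =
      n * (energyFactor K ε h * (8 * K) / Real.log 2) := by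
    rw [Real.logb, Real.log_exp]
    ring
  rw [e1, e2] at h4
  rw [packingConstant]
  linarith

end NonCoopCode

end

/-! ### Random orders of the nodes. -/

section

open Classical in
/-- The number of elements with property `p`. -/
def countWhere {Ω : Type*} [Fintype Ω] (p : Ω → Prop) : ℕ := (Finset.univ.filter p).card

theorem countWhere_congr {Ω : Type*} [Fintype Ω] {p q : Ω → Prop} (h : ∀ x, p x ↔ q x) :
    countWhere p = countWhere q := by
  rw [funext fun x => propext (h x)]

theorem countWhere_true {Ω : Type*} [Fintype Ω] :
    countWhere (fun _ : Ω => True) = Fintype.card Ω := by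
  simp [countWhere, Finset.card_univ]

theorem countWhere_or_add_and {Ω : Type*} [Fintype Ω] (p q : Ω → Prop) :
    countWhere (fun x => p x ∨ q x) + countWhere (fun x => p x ∧ q x)
      = countWhere p + countWhere q := by
  classical
  simp only [countWhere]
  convert Finset.card_union_add_card_inter (Finset.univ.filter p) (Finset.univ.filter q) using 3
  · ext; simp
  · ext; simp

/-- The event `q` is partitioned into `U.card` classes of equal size. Below, right multiplication by
a transposition shows that the sizes agree. -/
theorem card_mul_countWhere_eq {Ω α : Type*} [Fintype Ω] {U : Finset α} {q : Ω → Prop}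
    {C : α → Ω → Prop} {N : ℕ} (hq : ∀ σ, q σ ↔ ∃ d ∈ U, C d σ)
    (hC : ∀ d d' σ, C d σ → C d' σ → d = d') (hN : ∀ d ∈ U, countWhere (C d) = N) :
    U.card * N = countWhere q := by
  classical
  have h : Finset.univ.filter q = U.biUnion fun d => Finset.univ.filter (C d) := by
    ext σ
    simp [hq]
  have h2 : countWhere q = (Finset.univ.filter q).card := by
    unfold countWhere; congr
  rw [h2, h, Finset.card_biUnion]
  · rw [← smul_eq_mul, ← Finset.sum_const]
    refine Finset.sum_congr rfl fun d hd => ?_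
    rw [← hN d hd]
    unfold countWhere; congr
  · intro d _ d' _ hne
    refine Finset.disjoint_left.2 fun σ h1 h2 => hne ?_
    exact hC d d' σ (Finset.mem_filter.1 h1).2 (Finset.mem_filter.1 h2).2

section Permutations

variable {α : Type*} [Fintype α] [DecidableEq α]

theorem countWhere_mulRight (τ : Equiv.Perm α) (p : Equiv.Perm α → Prop) :
    countWhere (fun σ => p (σ * τ)) = countWhere p := by
  unfold countWhere
  exact Finset.card_equiv (Equiv.mulRight τ) (by simp)

theorem card_mul_card_perm_apply_eq (d a : α) :
    Fintype.card α * (countWhere fun σ : Equiv.Perm α => σ d = a)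
      = Fintype.card (Equiv.Perm α) := by
  have h := card_mul_countWhere_eq (U := Finset.univ) (q := fun _ : Equiv.Perm α => True)
    (C := fun d' (σ : Equiv.Perm α) => σ d' = a)
    (N := (countWhere fun σ : Equiv.Perm α => σ d = a))
    (fun σ => by simpa using ⟨σ.symm a, by simp⟩)
    (fun d d' σ h1 h2 => σ.injective (h1.trans h2.symm)) fun d' _ => by
      rw [← countWhere_mulRight (Equiv.swap d d')]
      simp
  simpa [Finset.card_univ, countWhere_true] using h

theorem card_mul_card_perm_apply_eq_and {m d a b : α} (hmd : d ≠ m) (hab : a ≠ b) :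
    (Fintype.card α - 1) * (countWhere fun σ : Equiv.Perm α => σ m = b ∧ σ d = a)
      = (countWhere fun σ : Equiv.Perm α => σ m = b) := by
  have h := card_mul_countWhere_eq (U := Finset.univ.erase m)
    (q := fun σ : Equiv.Perm α => σ m = b)
    (C := fun d' (σ : Equiv.Perm α) => σ m = b ∧ σ d' = a)
    (N := (countWhere fun σ : Equiv.Perm α => σ m = b ∧ σ d = a))
    (fun σ => ⟨fun h => ⟨σ.symm a, by
        simp only [Finset.mem_erase, Finset.mem_univ, and_true]
        intro h'
        rw [← h', Equiv.apply_symm_apply] at h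
        exact hab h, h, by simp⟩, fun ⟨_, _, h, _⟩ => h⟩)
    (fun d d' σ h1 h2 => σ.injective (h1.2.trans h2.2.symm)) fun d' hd' => by
      rw [← countWhere_mulRight (Equiv.swap d d')]
      have h1 : Equiv.swap d d' m = m :=
        Equiv.swap_apply_of_ne_of_ne hmd.symm (Finset.ne_of_mem_erase hd').symm
      simp [h1]
  simpa [Finset.card_erase_of_mem, Finset.card_univ] using h

theorem card_mul_card_perm_isMin [LinearOrder α] {m d b : α} {U : Finset α} (hm : m ∉ U)
    (hd : d ∈ U) :
    U.card * (countWhere fun σ : Equiv.Perm α => σ m = b ∧ ∀ x ∈ U, σ d ≤ σ x)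
      = (countWhere fun σ : Equiv.Perm α => σ m = b) := by
  refine card_mul_countWhere_eq (U := U) (q := fun σ : Equiv.Perm α => σ m = b)
    (C := fun d' (σ : Equiv.Perm α) => d' ∈ U ∧ σ m = b ∧ ∀ x ∈ U, σ d' ≤ σ x) ?_ ?_ ?_
  · intro σ
    refine ⟨fun h => ?_, fun ⟨_, _, _, h, _⟩ => h⟩
    obtain ⟨d', h1, h2⟩ := U.exists_min_image σ ⟨d, hd⟩
    exact ⟨d', h1, h1, h, h2⟩
  · intro d d' σ h1 h2
    exact σ.injective (le_antisymm (h1.2.2 _ h2.1) (h2.2.2 _ h1.1))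
  · intro d' hd'
    trans countWhere fun σ : Equiv.Perm α => d ∈ U ∧ σ m = b ∧ ∀ x ∈ U, σ d ≤ σ x
    swap
    · exact countWhere_congr fun σ => by simp [hd]
    rw [← countWhere_mulRight (Equiv.swap d d')]
    have h1 : Equiv.swap d d' m = m := Equiv.swap_apply_of_ne_of_ne
      (fun h => hm (h ▸ hd)) (fun h => hm (h ▸ hd'))
    have hU : ∀ x ∈ U, Equiv.swap d d' x ∈ U := by
      intro x hx
      rw [Equiv.swap_apply_def]
      split_ifs <;> assumption
    refine countWhere_congr fun σ => ?_
    simp only [hd, hd', true_and, Equiv.Perm.mul_apply, h1, Equiv.swap_apply_right]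
    refine and_congr_right fun _ => ⟨fun h x hx => ?_, fun h x hx => h _ (hU x hx)⟩
    simpa using h _ (hU x hx)

end Permutations

variable {K : ℕ} {ι : Type} {store : ι → Finset (Fin K)} {dest : ι → Fin K}

/-- Inclusion–exclusion: the destination is first with probability `1/K`; the holder `m` is last
with probability `1/K`, and given this the destination precedes the other holders with probability
`1/r`, where `r` is the number of holders; both occur with probability `1/(K(K-1))`. -/
theorem countWhere_isDecodable (hK : 2 ≤ K) {i : ι} (hi : dest i ∉ store i) (m : store i) :
    ((countWhere fun σ : Equiv.Perm (Fin K) => IsDecodable store dest σ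
      (σ.symm ⟨0, by omega⟩) (σ.symm ⟨K - 1, by omega⟩) ⟨i, m⟩) : ℝ)
      = Fintype.card (Equiv.Perm (Fin K)) *
        (1 / K + 1 / ((store i).card * K) - 1 / (K * (K - 1))) := by
  set d := dest i with hd
  set z : Fin K := ⟨0, by omega⟩ with hz
  set b : Fin K := ⟨K - 1, by omega⟩ with hb
  -- When `m` is last, it follows `d` automatically. Removing it leaves a set of `r` nodes not
  -- containing `m`, on which the minimum is uniform even given the position of `m`.
  set U := insert d ((store i).erase m) with hU
  have hzb : z ≠ b := fun h => by
    have := congrArg Fin.val h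
    simp only [hz, hb] at this
    omega
  have hmd : d ≠ m := fun h => hi (h ▸ m.2)
  have hmU : m.1 ∉ U := by simp [hU, hmd.symm]
  have hzle : ∀ x : Fin K, z ≤ x := fun x => Nat.zero_le _
  have hleb : ∀ x : Fin K, x ≤ b := fun x => Nat.le_sub_one_of_lt x.2
  have hUcard : U.card = (store i).card := by
    rw [hU, Finset.card_insert_of_notMem (by simp [hi]), Finset.card_erase_add_one m.2]
  have hunion : (countWhere fun σ : Equiv.Perm (Fin K) => IsDecodable store dest σ
      (σ.symm z) (σ.symm b) ⟨i, m⟩) = countWhere fun σ : Equiv.Perm (Fin K) =>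
        σ d = z ∨ (σ m = b ∧ ∀ x ∈ U, σ d ≤ σ x) := by
    refine countWhere_congr fun σ => or_congr
      ⟨fun h => by rw [hd, h.1, Equiv.apply_symm_apply], fun h => ?_⟩
      ⟨fun h => ?_, fun h => ?_⟩
    · have : d = σ.symm z := by rw [← h, Equiv.symm_apply_apply]
      exact ⟨this, this ▸ hi⟩
    · refine ⟨by rw [h.1, Equiv.apply_symm_apply], fun x hx => ?_⟩
      rcases Finset.mem_insert.1 hx with rfl | hx
      · exact le_rfl
      · exact (h.2 x (Finset.mem_of_mem_erase hx)).le
    · refine ⟨by rw [← h.1, Equiv.symm_apply_apply], fun x hx => ?_⟩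
      have hne : σ d ≠ σ x := fun h' => hi (σ.injective h' ▸ hx)
      refine lt_of_le_of_ne ?_ hne
      by_cases hxm : x = m
      · rw [hxm, h.1]
        exact hleb _
      · exact h.2 x (Finset.mem_insert_of_mem (Finset.mem_erase.2 ⟨hxm, hx⟩))
  have h1 := card_mul_card_perm_apply_eq d z
  have h2 := card_mul_card_perm_apply_eq m.1 b
  have h3 := card_mul_card_perm_apply_eq_and hmd hzb
  have h4 := card_mul_card_perm_isMin (b := b) hmU (Finset.mem_insert_self d _)
  have h5 := countWhere_or_add_and (fun σ : Equiv.Perm (Fin K) => σ d = z)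
    fun σ => σ m = b ∧ ∀ x ∈ U, σ d ≤ σ x
  have h6 : (countWhere fun σ : Equiv.Perm (Fin K) => σ d = z ∧ σ m = b ∧ ∀ x ∈ U, σ d ≤ σ x)
      = countWhere fun σ : Equiv.Perm (Fin K) => σ m = b ∧ σ d = z :=
    countWhere_congr fun σ =>
      ⟨fun h => ⟨h.2.1, h.1⟩, fun h => ⟨h.2, h.1, fun x _ => h.2 ▸ hzle _⟩⟩
  rw [hUcard] at h4
  rw [h6] at h5
  rw [Fintype.card_fin] at h1 h2 h3
  rw [hunion]
  have hr : (0 : ℝ) < (store i).card := Nat.cast_pos.2 (Finset.card_pos.2 ⟨m, m.2⟩)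
  have hK0 : (0 : ℝ) < K := by exact_mod_cast (by omega : 0 < K)
  have hK1 : (0 : ℝ) < K - 1 := by
    have : (2 : ℝ) ≤ K := by exact_mod_cast hK
    linarith
  generalize (countWhere fun σ : Equiv.Perm (Fin K) => σ m = b) = N at h2 h3 h4
  generalize (countWhere fun σ : Equiv.Perm (Fin K) => σ d = z) = a at h1 h5
  generalize (countWhere fun σ : Equiv.Perm (Fin K) => σ m = b ∧ σ d = z) = ab at h3 h5
  generalize (countWhere fun σ : Equiv.Perm (Fin K) => σ m = b ∧ ∀ x ∈ U, σ d ≤ σ x) = b' at h4 h5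
  have e1 : (a : ℝ) = Fintype.card (Equiv.Perm (Fin K)) * (1 / K) := by
    rw [← h1]; push_cast; field_simp
  have e2 : (N : ℝ) = Fintype.card (Equiv.Perm (Fin K)) * (1 / K) := by
    rw [← h2]; push_cast; field_simp
  have e3 : (ab : ℝ) = N * (1 / (K - 1)) := by
    rw [← h3]
    push_cast [Nat.cast_sub (by omega : 1 ≤ K)]
    field_simp
  have e4 : (b' : ℝ) = N * (1 / (store i).card) := by
    rw [← h4]; push_cast; field_simp
  have e5 : ((countWhere fun σ : Equiv.Perm (Fin K) =>
      σ d = z ∨ (σ m = b ∧ ∀ x ∈ U, σ d ≤ σ x) : ℕ) : ℝ) + ab = a + b' := by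
    exact_mod_cast h5
  rw [e3, e1, e4, e2] at e5
  rw [eq_sub_of_add_eq e5]
  field_simp

/-- Averaging a bound on the decodable sub-messages over all orders of the nodes. -/
theorem sum_mul_le_of_decodable_le [Fintype ι] (hK : 2 ≤ K) {r : ℕ} (hr : 1 ≤ r) {ℓ : ι → ℝ} (hℓ : ∀ i, 0 ≤ ℓ i)
    {I : Finset ι} (hI : ∀ i ∈ I, dest i ∉ store i ∧ (store i).card = r) {B : ℝ}
    (hB : ∀ (σ : Equiv.Perm (Fin K)) (k j : Fin K), k ≠ j → (∀ q, σ k ≤ σ q) →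
      ∑ x ∈ NonCoopCode.decodable store dest σ k j, ℓ x.1 ≤ B) :
    (∑ i ∈ I, ℓ i) * ((((K : ℝ) - 2) * r + K - 1) / (K * (K - 1))) ≤ B := by
  set z : Fin K := ⟨0, by omega⟩ with hz
  set b : Fin K := ⟨K - 1, by omega⟩ with hb
  have hzb : z ≠ b := fun h => by
    have := congrArg Fin.val h
    simp only [hz, hb] at this
    omega
  have h1 : ∑ σ : Equiv.Perm (Fin K),
      ∑ x ∈ NonCoopCode.decodable store dest σ (σ.symm z) (σ.symm b), ℓ x.1
      ≤ Fintype.card (Equiv.Perm (Fin K)) * B := by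
    refine (Finset.sum_le_sum fun σ _ => hB σ _ _ (fun h => hzb (σ.symm.injective h))
      fun q => ?_).trans (le_of_eq ?_)
    · rw [Equiv.apply_symm_apply]
      exact Nat.zero_le _
    · rw [Finset.sum_const, Finset.card_univ, nsmul_eq_mul]
  have h2 : ∑ σ : Equiv.Perm (Fin K),
      ∑ x ∈ NonCoopCode.decodable store dest σ (σ.symm z) (σ.symm b), ℓ x.1
      = ∑ i, ∑ m : store i, ℓ i * (countWhere fun σ : Equiv.Perm (Fin K) =>
        IsDecodable store dest σ (σ.symm z) (σ.symm b) ⟨i, m⟩) := by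
    simp_rw [NonCoopCode.decodable, Finset.sum_filter, countWhere]
    rw [Finset.sum_comm, Fintype.sum_sigma]
    refine Finset.sum_congr rfl fun i _ => Finset.sum_congr rfl fun m _ => ?_
    rw [← Finset.sum_filter, Finset.sum_const, nsmul_eq_mul, mul_comm]
  have h3 : ∑ i ∈ I, ∑ m : store i, ℓ i * ((countWhere fun σ : Equiv.Perm (Fin K) =>
        IsDecodable store dest σ (σ.symm z) (σ.symm b) ⟨i, m⟩) : ℝ)
      ≤ Fintype.card (Equiv.Perm (Fin K)) * B := by
    rw [h2] at h1
    refine le_trans (Finset.sum_le_sum_of_subset_of_nonneg (Finset.subset_univ _)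
      fun i _ _ => Finset.sum_nonneg fun m _ => mul_nonneg (hℓ i) (Nat.cast_nonneg _)) h1
  have hK0 : (0 : ℝ) < K := by exact_mod_cast (by omega : 0 < K)
  have hK1 : (0 : ℝ) < K - 1 := by
    have : (2 : ℝ) ≤ K := by exact_mod_cast hK
    linarith
  have hr0 : (0 : ℝ) < r := by exact_mod_cast hr
  have h4 : ∑ i ∈ I, ∑ m : store i, ℓ i * ((countWhere fun σ : Equiv.Perm (Fin K) =>
        IsDecodable store dest σ (σ.symm z) (σ.symm b) ⟨i, m⟩) : ℝ)
      = Fintype.card (Equiv.Perm (Fin K)) *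
        ((∑ i ∈ I, ℓ i) * ((((K : ℝ) - 2) * r + K - 1) / (K * (K - 1)))) := by
    rw [Finset.sum_mul, Finset.mul_sum]
    refine Finset.sum_congr rfl fun i hi => ?_
    have h5 : ∀ m : store i, ((countWhere fun σ : Equiv.Perm (Fin K) =>
        IsDecodable store dest σ (σ.symm z) (σ.symm b) ⟨i, m⟩) : ℝ)
        = Fintype.card (Equiv.Perm (Fin K)) * (1 / K + 1 / (r * K) - 1 / (K * (K - 1))) := by
      intro m
      rw [← (hI i hi).2]
      exact countWhere_isDecodable hK (hI i hi).1 m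
    simp_rw [h5]
    -- All `r` sub-messages have the same probability, and `r` times it is `((K-2)r + K-1) /
    -- (K(K-1))`.
    rw [Finset.sum_const, Finset.card_univ, Fintype.card_coe, (hI i hi).2, nsmul_eq_mul]
    field_simp
    ring
  rw [h4] at h3
  have hpos : (0 : ℝ) < Fintype.card (Equiv.Perm (Fin K)) := Nat.cast_pos.2 Fintype.card_pos
  exact le_of_mul_le_mul_left h3 hpos

end

/-! ### The uniform converse and the two limits. -/

/-- The weak converse with a prefactor arbitrarily close to one, uniform in the code, the
blocklength and the power. -/
theorem exists_sum_logb_mul_le {K r : ℕ} (hK : 2 ≤ K) (hr : 1 ≤ r) (ν : Measure ℝ)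
    [IsProbabilityMeasure ν] [NullSingletonClass ν] {Hmax : ℝ}
    (hν : ∀ᵐ x ∂ν, x ∈ Set.Icc (-Hmax) Hmax) {p : ℝ} (hp : 0 < p) :
    ∃ C : ℝ, 0 ≤ C ∧ ∀ {ι : Type} [Fintype ι] {store : ι → Finset (Fin K)} {dest : ι → Fin K}
      {L : ι → ℕ} {n : ℕ} (c : NonCoopCode store dest L n) {P : ℝ} (I : Finset ι),
      (∀ i, 0 < L i) → 1 ≤ P → c.PowerConstraint ν P → c.errorProb ν ≤ ENNReal.ofReal (1 / 4) →
      (∀ i ∈ I, dest i ∉ store i ∧ (store i).card = r) →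
      (∑ i ∈ I, Real.logb 2 (L i)) * ((((K : ℝ) - 2) * r + K - 1) / (K * (K - 1)))
        ≤ 2 + n * (C + (1 + 4 * K * p) * Real.logb 2 P) := by
  -- The threshold `ε`, and hence the constant `C`, depends on `p` but not on `P` or `n`, so `C` is
  -- negligible against `log P`.
  obtain ⟨ε, hε0, hε⟩ := exists_complexLaw_norm_lt_le (ν := ν) hp
  refine ⟨max 0 (packingConstant K ε (2 * |Hmax|)), le_max_left _ _, ?_⟩
  intro ι _ store dest L n c P I hL hP hc herr hI
  refine sum_mul_le_of_decodable_le hK hr (ℓ := fun i => Real.logb 2 (L i))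
    (fun i => Real.logb_nonneg one_lt_two (by exact_mod_cast hL i)) hI fun σ k j hkj hk => ?_
  refine (c.sum_decodable_logb_le ν hL hP hp hε0 (by positivity) hε (ae_norm_complexLaw_le hν)
    hkj hk hc herr).trans ?_
  gcongr
  exact le_max_right _ _

theorem tendsto_logb_two_atTop : Tendsto (fun P : ℝ => Real.logb 2 P) atTop atTop :=
  Real.tendsto_logb_atTop one_lt_two

theorem le_ndt_of_achievable {K r M : ℕ} (hK : 2 ≤ K) (hr : 1 ≤ r) (hrK : r ≤ K) (hM : 1 ≤ M)
    (ν : Measure ℝ) [IsProbabilityMeasure ν] [NullSingletonClass ν] {Hmax : ℝ}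
    (hν : ∀ᵐ x ∂ν, x ∈ Set.Icc (-Hmax) Hmax) {S : Fin M → Finset (Fin K)} {n : ℝ → ℕ → ℕ}
    (c : (P : ℝ) → (B : ℕ) → ShuffleCode S B (n P B)) (hS : IsCombinatorialAssignment r S)
    (hc : ∀ P : ℝ, 0 < P → (∀ B, (c P B).PowerConstraint ν P) ∧
      Tendsto (fun B => (c P B).errorProb ν) atTop (𝓝 0)) :
    (((1 / (K : ℝ)) * (1 - (r : ℝ) / K) *
        ((((K : ℝ) - 2) * r + K - 1) / ((r : ℝ) * ((K : ℝ) - 1))) : ℝ) : EReal)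
      ≤ ndt K r M n := by
  have hK2 : (2 : ℝ) ≤ K := by exact_mod_cast hK
  have hK1 : (0 : ℝ) < K - 1 := by linarith
  have hK0 : (0 : ℝ) < K := by linarith
  have hr0 : (0 : ℝ) < r := by exact_mod_cast hr
  have hM0 : (0 : ℝ) < M := by exact_mod_cast hM
  set β := (1 / (K : ℝ)) * (1 - (r : ℝ) / K) *
    ((((K : ℝ) - 2) * r + K - 1) / ((r : ℝ) * ((K : ℝ) - 1))) with hβ
  refine EReal.ge_of_forall_gt_iff_ge.1 fun a ha => ?_
  have ha' : a < β := EReal.coe_lt_coe_iff.1 ha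
  unfold ndt
  -- For `a ≤ 0` nonnegativity of the delivery time suffices; this also settles `r = K`, where `β =
  -- 0`.
  rcases le_or_gt a 0 with ha0 | ha0
  · refine le_liminf_of_le (by isBoundedDefault) ?_
    filter_upwards [eventually_ge_atTop 1] with P hP
    refine le_liminf_of_le (by isBoundedDefault) (Eventually.of_forall fun B => ?_)
    refine EReal.coe_le_coe_iff.2 (ha0.trans ?_)
    have := Real.logb_nonneg one_lt_two hP
    positivity
  have hβ0 : 0 < β := ha0.trans ha'
  -- This `p` makes `a * s` the midpoint of `a` and `β`. The remaining gap absorbs `C` for large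
  -- `P`, and then the additive `2` for large `B`.
  obtain ⟨C, hC, hbound⟩ := exists_sum_logb_mul_le hK hr ν hν
    (p := (β / a - 1) / (8 * K)) (by
      have : 1 < β / a := (one_lt_div ha0).2 ha'
      have : 0 < β / a - 1 := by linarith
      positivity)
  set s := 1 + 4 * K * ((β / a - 1) / (8 * K)) with hs
  have hs' : a * s = (a + β) / 2 := by
    rw [hs]
    field_simp
    ring
  have hs0 : 0 < s := by
    have : 0 < a * s := by rw [hs']; linarith
    exact (mul_pos_iff_of_pos_left ha0).1 this
  have hgap : 0 < β - a * s := by rw [hs']; linarith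
  refine le_liminf_of_le (by isBoundedDefault) ?_
  filter_upwards [eventually_ge_atTop 1, tendsto_logb_two_atTop.eventually_gt_atTop 0,
    tendsto_logb_two_atTop.eventually_gt_atTop (a * C / (β - a * s))] with P hP hl0 hl
  set l := Real.logb 2 P with hl_def
  have hγ : 0 < β * l - a * (C + s * l) := by
    rw [div_lt_iff₀ hgap] at hl
    nlinarith
  obtain ⟨hpow, herr⟩ := hc P (by linarith)
  refine le_liminf_of_le (by isBoundedDefault) ?_
  filter_upwards [eventually_ge_atTop 1, tendsto_natCast_atTop_atTop.eventually_ge_atTop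
      (2 * l / (r * K * M * (β * l - a * (C + s * l)))),
    herr.eventually (ge_mem_nhds (ENNReal.ofReal_pos.2 (by norm_num : (0 : ℝ) < 1 / 4)))]
    with B hB1 hB hBerr
  refine EReal.coe_le_coe_iff.2 ?_
  have hB0 : (0 : ℝ) < B := by exact_mod_cast hB1
  have h1 := hbound (c P B) (Finset.univ.filter fun i : Fin K × Fin M => i.1 ∉ S i.2)
    (fun i => by positivity) hP (hpow B) hBerr fun i hi => ⟨(Finset.mem_filter.1 hi).2, hS i.2⟩
  have hcard : ((Finset.univ.filter fun i : Fin K × Fin M => i.1 ∉ S i.2).card : ℝ)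
      = M * (K - r) := by
    have h2 : ∀ m : Fin M, ∑ k : Fin K, (if k ∉ S m then 1 else 0) = K - r := by
      intro m
      rw [← Finset.card_filter]
      have : (Finset.univ.filter fun k => k ∉ S m) = (S m)ᶜ := by ext; simp
      rw [this, Finset.card_compl, Fintype.card_fin, hS m]
    rw [Finset.card_filter, Fintype.sum_prod_type_right]
    simp_rw [h2]
    rw [Finset.sum_const, Finset.card_univ, Fintype.card_fin, smul_eq_mul]
    push_cast [Nat.cast_sub hrK]
    ring
  have hlog : Real.logb 2 ((2 ^ B : ℕ) : ℝ) = B := by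
    push_cast
    rw [Real.logb_pow, Real.logb_self_eq_one one_lt_two, mul_one]
  rw [Finset.sum_const, hlog, nsmul_eq_mul, hcard] at h1
  have hQ : (M * (K - r) * B : ℝ) * ((((K : ℝ) - 2) * r + K - 1) / (K * (K - 1)))
      = B * (β * (r * K * M)) := by
    rw [hβ]
    field_simp
  rw [hQ] at h1
  have hD : 0 < C + s * l := by positivity
  have h3 : 2 * l ≤ B * (r * K * M * (β * l - a * (C + s * l))) := by
    rwa [div_le_iff₀ (by positivity)] at hB
  -- Multiplying `h1` by `l` and inserting `h3` leaves the common factor `C + s * l`.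
  have h4 : a * (r * B * K * M) * (C + s * l) ≤ n P B * l * (C + s * l) := by
    have := mul_le_mul_of_nonneg_right h1 hl0.le
    nlinarith
  have h5 := le_of_mul_le_mul_right h4 hD
  rw [div_mul_eq_mul_div, le_div_iff₀ (by positivity)]
  push_cast
  exact h5

/-- Rounding up only lengthens the messages, and the additive `2` is negligible per channel use: one
large `n` with small error contradicts a larger rate. -/
theorem sum_rate_le_of_achievable {K r : ℕ} (ν : Measure ℝ) {P D ω : ℝ} (hr : 1 ≤ r) (hω : 0 < ω)
    {R : CoopIndex K r → ℝ} (hR : IsAchievableRate ν P R)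
    (hbound : ∀ {L : CoopIndex K r → ℕ} {n : ℕ}
      (c : NonCoopCode (ι := CoopIndex K r) (fun i => i.1.2) (fun i => i.1.1) L n),
      (∀ i, 0 < L i) → c.PowerConstraint ν P → c.errorProb ν ≤ ENNReal.ofReal (1 / 4) →
      (∑ i, Real.logb 2 (L i)) * ω ≤ 2 + n * D) :
    (∑ i, R i) * ω ≤ r * D := by
  obtain ⟨_, c, hpow, herr⟩ := hR
  have hr0 : (0 : ℝ) < r := by exact_mod_cast hr
  by_contra! hlt
  have hγ : 0 < (∑ i, R i) * ω - r * D := by linarith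
  obtain ⟨n, hn, hnerr⟩ := ((tendsto_natCast_atTop_atTop.eventually_gt_atTop
    (2 * r / ((∑ i, R i) * ω - r * D))).and (herr.eventually (ge_mem_nhds
      (ENNReal.ofReal_pos.2 (by norm_num : (0 : ℝ) < 1 / 4))))).exists
  have h1 := hbound (c n) (fun i => Nat.ceil_pos.2 (by positivity)) (hpow n) hnerr
  have h2 : ∑ i, (n : ℝ) * R i / r ≤
      ∑ i, Real.logb 2 ((⌈(2 : ℝ) ^ ((n : ℝ) * R i / r)⌉₊ : ℕ) : ℝ) := by
    refine Finset.sum_le_sum fun i _ => ?_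
    rw [Real.le_logb_iff_rpow_le one_lt_two (Nat.cast_pos.2 (Nat.ceil_pos.2 (by positivity)))]
    exact Nat.le_ceil _
  have h3 := (mul_le_mul_of_nonneg_right h2 hω.le).trans h1
  rw [← Finset.sum_div, ← Finset.mul_sum, div_mul_eq_mul_div, div_le_iff₀ hr0] at h3
  rw [div_lt_iff₀ hγ] at hn
  linarith

theorem sumDoF_le {K r : ℕ} (hK : 2 ≤ K) (hr : 1 ≤ r)
    (ν : Measure ℝ) [IsProbabilityMeasure ν] [NullSingletonClass ν] {Hmax : ℝ}
    (hν : ∀ᵐ x ∂ν, x ∈ Set.Icc (-Hmax) Hmax) :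
    sumDoF K r ν
      ≤ (((K : ℝ) * ((K : ℝ) - 1) * r / (((K : ℝ) - 2) * r + K - 1) : ℝ) : EReal) := by
  have hK2 : (2 : ℝ) ≤ K := by exact_mod_cast hK
  have hK1 : (0 : ℝ) < K - 1 := by linarith
  have hK0 : (0 : ℝ) < K := by linarith
  have hr0 : (0 : ℝ) < r := by exact_mod_cast hr
  have hnum : 0 < ((K : ℝ) - 2) * r + K - 1 := by nlinarith
  set β := (K : ℝ) * ((K : ℝ) - 1) * r / (((K : ℝ) - 2) * r + K - 1) with hβ
  have hβ0 : 0 < β := by positivity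
  refine EReal.le_of_forall_lt_iff_le.1 fun a ha => ?_
  have ha' : β < a := EReal.coe_lt_coe_iff.1 ha
  -- Here `p` makes `β * s` the midpoint of `β` and `a`.
  obtain ⟨C, hC, hbound⟩ := exists_sum_logb_mul_le hK hr ν hν
    (p := (a / β - 1) / (8 * K)) (by
      have : 1 < a / β := (one_lt_div hβ0).2 ha'
      have : 0 < a / β - 1 := by linarith
      positivity)
  set s := 1 + 4 * K * ((a / β - 1) / (8 * K)) with hs
  have hs' : β * s = (a + β) / 2 := by
    rw [hs]
    field_simp
    ring
  have hgap : 0 < a - β * s := by rw [hs']; linarith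
  refine limsup_le_of_le (by isBoundedDefault) ?_
  filter_upwards [eventually_ge_atTop 1, tendsto_logb_two_atTop.eventually_gt_atTop 0,
    tendsto_logb_two_atTop.eventually_gt_atTop (β * C / (a - β * s))] with P hP hl0 hl
  refine iSup₂_le fun R hR => EReal.coe_le_coe_iff.2 ?_
  have hω : 0 < (((K : ℝ) - 2) * r + K - 1) / (K * (K - 1)) := by positivity
  have h1 := sum_rate_le_of_achievable ν hr hω hR (D := C + s * Real.logb 2 P)
    fun c hL hpow herr => hbound c Finset.univ hL hP hpow herr
      fun i _ => ⟨i.2.2, i.2.1⟩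
  have h2 : (r : ℝ) = β * ((((K : ℝ) - 2) * r + K - 1) / (K * (K - 1))) := by
    rw [hβ, div_mul_div_comm, eq_div_iff (mul_pos hnum (mul_pos hK0 hK1)).ne']
    ring
  have h3 : ∑ i, R i ≤ β * (C + s * Real.logb 2 P) := by
    refine le_of_mul_le_mul_right (h1.trans (le_of_eq ?_)) hω
    nth_rewrite 1 [h2]
    ring
  rw [div_lt_iff₀ hgap] at hl
  rw [div_le_iff₀ hl0]
  nlinarith

end WirelessMapReduce

end

theorem theorem2 (K r M : ℕ) (hK : 5 ≤ K) (hr : 1 ≤ r) (hrK : r ≤ K) (hM : 1 ≤ M)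
    (ν : Measure ℝ) [IsProbabilityMeasure ν] [NullSingletonClass ν]
    (Hmax : ℝ) (hν : ∀ᵐ x ∂ν, x ∈ Set.Icc (-Hmax) Hmax) :
    (((1 / (K : ℝ)) * (1 - (r : ℝ) / K) *
        ((((K : ℝ) - 2) * r + K - 1) / ((r : ℝ) * ((K : ℝ) - 1))) : ℝ) : EReal)
      ≤ WirelessMapReduce.optimalNDT K r M ν ∧
    WirelessMapReduce.sumDoF K r ν
      ≤ (((K : ℝ) * ((K : ℝ) - 1) * r / (((K : ℝ) - 2) * r + K - 1) : ℝ) : EReal) := by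
  refine ⟨le_sInf ?_, WirelessMapReduce.sumDoF_le (by omega) hr ν hν⟩
  rintro Δ ⟨S, n, c, hS, hc, rfl⟩
  exact WirelessMapReduce.le_ndt_of_achievable (by omega) hr hrK hM ν hν c hS hc
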